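/- All graphs are finite, undirected and simple. For a graph $G$ let $c(G)$ be its number of connected components and let $\rho(G)$ be its spectral radius, i.e. the largest eigenvalue of its adjacency matrix. For real $\tau$, $G$ is $\tau$-tough if $|S|\ge \tau\, c(G-S)$ for every $S\subseteq V(G)$ with $c(G-S)\ge 2$. A spanning $k$-tree of $G$ is a spanning subgraph of $G$ that is a tree with all degrees at most $k$. $K_m$ is the complete graph on $m$ vertices, $rK_1$ is the graph with $r$ vertices and no edges, $\cup$ denotes disjoint union, and $G_1\vee G_2$ is $G_1\cup G_2$ together with all edges between $V(G_1)$ and $V(G_2)$. **Theorem.** Let $k\ge 3$ and $t\ge 1$ be integers, and let $G$ be a connected $\frac{t}{t(k-2)+1}$-tough graph with $n$ vertices, where $n\ge 3kt+k-3t+6$. If $$\rho(G)\ \ge\ \rho\bigl(K_{3t}\vee(K_{n-3t(k-1)-2}\cup(3t(k-2)+2)K_1)\bigr),$$ then $G$ has a spanning $k$-tree or $G\cong K_{3t}\vee(K_{n-3t(k-1)-2}\cup(3t(k-2)+2)K_1)$. -/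

import Mathlib

namespace ToughTree

/-- The join of two disjoint graphs: their disjoint union together with all edges between the
two vertex sets. -/
def join {V W : Type*} (G : SimpleGraph V) (H : SimpleGraph W) : SimpleGraph (V ⊕ W) :=
  (G ⊕g H) ⊔ completeBipartiteGraph V W

/-- The number of connected components of the graph obtained from `G` by deleting the vertices
of `S` (together with all edges incident to them). -/
noncomputable def compCount {V : Type*} (G : SimpleGraph V) (S : Finset V) : ℕ :=
  Nat.card (G.induce ((S : Set V)ᶜ)).ConnectedComponent

/-- `G` is `τ`-tough: `|S| ≥ τ * c(G - S)` for every vertex subset `S` with `c(G - S) ≥ 2`. -/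
def IsTough {V : Type*} (G : SimpleGraph V) (τ : ℝ) : Prop :=
  ∀ S : Finset V, 2 ≤ compCount G S → τ * (compCount G S : ℝ) ≤ (S.card : ℝ)

open Classical in
/-- The spectral radius of a finite graph: the largest eigenvalue of its adjacency matrix. The
set of real eigenvalues is finite, and for a graph with at least one vertex it is nonempty, so
that the supremum is a maximum. -/
noncomputable def specRadius {V : Type*} [Fintype V] (G : SimpleGraph V) : ℝ :=
  sSup {μ : ℝ | Module.End.HasEigenvalue (Matrix.toLin' (G.adjMatrix ℝ)) μ}

/-- `G` has a spanning `k`-tree: a spanning subgraph that is a tree in which every vertex has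
degree at most `k`. -/
def HasSpanningKTree {V : Type*} [Fintype V] (G : SimpleGraph V) (k : ℕ) : Prop :=
  ∃ T : SimpleGraph V, T ≤ G ∧ T.IsTree ∧ ∀ v : V, (T.neighborSet v).ncard ≤ k

/-- The graph `K_a ∨ (K_b ∪ c K_1)`. -/
def cliqueJoin (a b c : ℕ) : SimpleGraph (Fin a ⊕ (Fin b ⊕ Fin c)) :=
  join (SimpleGraph.completeGraph (Fin a)) (SimpleGraph.completeGraph (Fin b) ⊕g SimpleGraph.emptyGraph (Fin c))

end ToughTree

/-!
The hypotheses force a spanning `k`-tree outright: already the weaker bound that comes from the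
complete subgraph on `q + 1` vertices of the extremal graph, `q = n - 3t(k - 2) - 3 ≤ ρ(G)`, excludes
all graphs without one. Suppose that `G` has no spanning `k`-tree.

* Choose a spanning tree `T` whose degrees exceed `k` by the least total amount, and subject to that
  with the fewest vertices of degree at least `k`. Win's exchange argument gives a set `S` of vertices
  of `T`-degree at least `k`, containing all those of larger degree, such that `G - S` and `T - S`
  have the same components (`IsOptimal.exists_saturated`). Counting degrees in `T` yields
  `c(G - S) ≥ (k - 2)|S| + 2 + f`, where `f` is the number of components of `T[S]`.
* By the second minimality, a vertex outside `S` whose `T`-degree is at most `k - 2` has at most one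
  neighbour in `G` in each component of `T[S]`, hence at most `f` neighbours in `S`. The set `H` of
  the other vertices outside `S` is small, again by counting degrees in `T` (`exists_obstruction`).
* Write `c(G - S) = (k - 2)|S| + 2 + F` with `F ≥ f`. Toughness gives `t (F + 2) ≤ |S|`. The edges
  between `S` and its complement are bounded by means of `H` and `F` (`sum_degree_le`), those of
  `G - S` by means of the number of its components (`sum_degree_add_mul_card_le`). The result is a
  polynomial bound on the number `m` of edges, and `2m - n + 1 < q²` becomes an inequality between
  integers (`edge_bound_lt`). The inequality may fail by one for `k = 3`, `t = 1`, `|S| = 3`. In that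
  case toughness also provides two components of `G - S` with more than one vertex
  (`exists_three_le_compCount_singleton`), which lowers the bound on the edges of `G - S`.
* Hong's bound `ρ(G)² ≤ 2m - n + 1` (`specRadius_le_sqrt`, `sum_degree_neighbors_add_le`) then gives
  `ρ(G) < q`, whereas `q ≤ ρ(G)` by the complete subgraph on `q + 1` vertices in the extremal graph
  (`card_sub_one_le_specRadius_cliqueJoin`).
-/

namespace ToughTree

/-! ### Branches and edge exchanges -/

section Exchange

open Classical

variable {V : Type*}

/-- `u` and `v` lie in the same branch of `T` at `a`: some walk of `T` joins them without meeting
`a`. -/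
def SameBranch (T : SimpleGraph V) (a u v : V) : Prop :=
  ∃ p : T.Walk u v, a ∉ p.support

variable {T G H : SimpleGraph V} {a u v w x y z : V}

theorem SameBranch.refl (h : u ≠ a) : SameBranch T a u u :=
  ⟨.nil, by simpa using h.symm⟩

theorem SameBranch.symm (h : SameBranch T a u v) : SameBranch T a v u := by
  obtain ⟨p, hp⟩ := h
  exact ⟨p.reverse, by simpa using hp⟩

theorem SameBranch.trans (h : SameBranch T a u v) (h' : SameBranch T a v w) :
    SameBranch T a u w := by
  obtain ⟨p, hp⟩ := h
  obtain ⟨q, hq⟩ := h'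
  exact ⟨p.append q, by simp [SimpleGraph.Walk.mem_support_append_iff, hp, hq]⟩

theorem SameBranch.of_adj (h : T.Adj u v) (hu : u ≠ a) (hv : v ≠ a) : SameBranch T a u v :=
  ⟨.cons h .nil, by simp [hu.symm, hv.symm]⟩

theorem SameBranch.ne_left (h : SameBranch T a u v) : u ≠ a := by
  obtain ⟨p, hp⟩ := h
  rintro rfl
  exact hp p.start_mem_support

theorem SameBranch.ne_right (h : SameBranch T a u v) : v ≠ a := h.symm.ne_left

/-- In a connected graph every branch at `a` is entered by an edge at `a`. -/
theorem exists_adj_sameBranch (hT : T.Connected) (h : u ≠ a) :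
    ∃ w, T.Adj a w ∧ SameBranch T a u w := by
  have key : ∀ {s t : V} (_ : T.Walk s t), s ≠ t → ∃ w, T.Adj t w ∧ SameBranch T t s w := by
    intro s t p
    induction p with
    | nil => exact fun h => absurd rfl h
    | @cons s s' t hadj p ih =>
      intro hs
      by_cases hs' : s' = t
      · subst hs'
        exact ⟨s, hadj.symm, .refl hs⟩
      · obtain ⟨w, hw, hb⟩ := ih hs'
        exact ⟨w, hw, (SameBranch.of_adj hadj hs hs').trans hb⟩
  exact key (hT.preconnected u a).some h

theorem sameBranch_eq_of_adj (hT : T.IsTree) (hu : T.Adj a u) (hv : T.Adj a v)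
    (h : SameBranch T a u v) : u = v := by
  obtain ⟨p, hp⟩ := h
  have hpath : (SimpleGraph.Walk.cons hu p.bypass).IsPath := by
    rw [SimpleGraph.Walk.cons_isPath_iff]
    exact ⟨p.bypass_isPath, fun h => hp (p.support_bypass_subset_support h)⟩
  have h2 : (SimpleGraph.Walk.cons hv .nil : T.Walk a v).IsPath := by
    simp [SimpleGraph.Walk.cons_isPath_iff, hv.ne]
  have := (hT.existsUnique_path a v).unique hpath h2
  simpa using congrArg SimpleGraph.Walk.snd this

/-- The graph that follows `H₁` on the branch of `x` at `z` and `H₂` elsewhere: the edges of `H₁`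
with an end in this branch, and the edges of `H₂` without. -/
def splice (T : SimpleGraph V) (z x : V) (H₁ H₂ : SimpleGraph V) : SimpleGraph V where
  Adj u v := (H₁.Adj u v ∧ (SameBranch T z x u ∨ SameBranch T z x v)) ∨
    (H₂.Adj u v ∧ ¬ SameBranch T z x u ∧ ¬ SameBranch T z x v)
  symm := ⟨fun u v h => by
    rcases h with ⟨h, h'⟩ | ⟨h, h', h''⟩
    · exact .inl ⟨h.symm, h'.symm⟩
    · exact .inr ⟨h.symm, h'', h'⟩⟩
  loopless := ⟨fun u h => by
    rcases h with ⟨h, -⟩ | ⟨h, -⟩ <;> exact h.ne rfl⟩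

/-- A walk of `H` that starts at a vertex with property `P` and ends at `z` can be followed in `K`
if `P` and the edges between vertices other than `z` carry over, and so do the last steps. -/
theorem reachable_of_walk {P : V → Prop} {H K : SimpleGraph V}
    (hstep : ∀ u v, P u → H.Adj u v → v ≠ z → P v ∧ K.Adj u v)
    (hlast : ∀ u, P u → H.Adj u z → K.Reachable u z) (p : H.Walk u z) (hu : P u) :
    K.Reachable u z := by
  induction p with
  | nil => exact .refl _
  | @cons s s' t hadj p ih =>
    by_cases hs' : s' = t
    · subst hs'
      exact hlast _ hu hadj
    · obtain ⟨h1, h2⟩ := hstep _ _ hu hadj hs'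
      exact h2.reachable.trans (ih hstep hlast h1)

theorem connected_of_reachable (z : V) (h : ∀ u, H.Reachable u z) : H.Connected :=
  haveI : Nonempty V := ⟨z⟩
  ⟨fun u v => (h u).trans (h v).symm⟩

/-- The graph `H` with the edge `xy` added and the edge `zw` removed. -/
def exchange (H : SimpleGraph V) (x y z w : V) : SimpleGraph V :=
  (H ⊔ SimpleGraph.edge x y) \ SimpleGraph.edge z w

theorem exchange_adj (hxy : x ≠ y) (hzw : z ≠ w) : (exchange H x y z w).Adj u v ↔
    (H.Adj u v ∨ (u = x ∧ v = y) ∨ (u = y ∧ v = x)) ∧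
      ¬ ((u = z ∧ v = w) ∨ (u = w ∧ v = z)) := by
  simp only [exchange, SimpleGraph.sdiff_adj, SimpleGraph.sup_adj, SimpleGraph.edge_adj]
  grind

variable [Fintype V] {k : ℕ} {A : Finset V}

/-- `H` is a connected spanning subgraph of `G` that respects the branches of `T` at all vertices
of `A`: its edges do not join two such branches, and it enters each of them at most once. Outside
`A` its degrees are at most `k`. Inside `A` they are then at most those of `T`. -/
structure Respects (G T : SimpleGraph V) (k : ℕ) (A : Finset V) (H : SimpleGraph V) : Prop where
  le : H ≤ G
  conn : H.Connected
  edge : ∀ a ∈ A, ∀ u v, H.Adj u v → u ≠ a → v ≠ a → SameBranch T a u v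
  nbr : ∀ a ∈ A, ∀ u v, H.Adj a u → H.Adj a v → SameBranch T a u v → u = v
  deg : ∀ v, v ∉ A → H.degree v ≤ k

theorem respects_self (hTG : T ≤ G) (hT : T.IsTree) (hA : ∀ v, v ∉ A → T.degree v ≤ k) :
    Respects G T k A T where
  le := hTG
  conn := hT.connected
  edge _ _ _ _ h hu hv := .of_adj h hu hv
  nbr _ _ _ _ hu hv h := sameBranch_eq_of_adj hT hu hv h
  deg := hA

theorem Respects.degree_le (hT : T.Connected) (hH : Respects G T k A H) (ha : a ∈ A) :
    H.degree a ≤ T.degree a := by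
  have hex : ∀ u, ∃ w, u ∈ H.neighborFinset a → T.Adj a w ∧ SameBranch T a u w := by
    intro u
    by_cases hu : u ∈ H.neighborFinset a
    · obtain ⟨w, hw⟩ := exists_adj_sameBranch (T := T) hT
        ((SimpleGraph.mem_neighborFinset _ _ _).1 hu).ne'
      exact ⟨w, fun _ => hw⟩
    · exact ⟨u, fun h => absurd h hu⟩
  choose φ hφ using hex
  refine Finset.card_le_card_of_injOn φ (fun u hu => ?_) (fun u hu v hv huv => ?_)
  · simpa using (hφ u hu).1
  · have h1 := (hφ u hu).2
    have h2 := (hφ v hv).2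
    rw [← huv] at h2
    exact hH.nbr a ha u v (by simpa using hu) (by simpa using hv) (h1.trans h2.symm)

theorem Respects.mono (hT : T.Connected) (hH : Respects G T k A H) {A' : Finset V} (hA : A' ⊆ A)
    (hdeg : ∀ v ∈ A, v ∉ A' → T.degree v ≤ k) : Respects G T k A' H where
  le := hH.le
  conn := hH.conn
  edge a ha := hH.edge a (hA ha)
  nbr a ha := hH.nbr a (hA ha)
  deg v hv := by
    by_cases h : v ∈ A
    · exact (hH.degree_le hT h).trans (hdeg v h hv)
    · exact hH.deg v h

/-- Graphs respecting the branches at `A` can be combined along the branches at a vertex of `A`. -/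
theorem Respects.splice {H₁ H₂ : SimpleGraph V} (h₁ : Respects G T k A H₁)
    (h₂ : Respects G T k A H₂) (hz : z ∈ A) :
    Respects G T k A (splice T z x H₁ H₂) := by
  have side₁ : ∀ u v, H₁.Adj u v → SameBranch T z x u → v = z ∨ SameBranch T z x v := by
    intro u v h hu
    by_cases hv : v = z
    · exact .inl hv
    · exact .inr (hu.trans (h₁.edge z hz u v h hu.ne_right hv))
  refine ⟨?_, ?_, ?_, ?_, ?_⟩
  · intro u v h
    rcases h with ⟨h, -⟩ | ⟨h, -⟩
    · exact h₁.le h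
    · exact h₂.le h
  · refine connected_of_reachable z fun u => ?_
    by_cases hu : SameBranch T z x u
    · refine reachable_of_walk (P := SameBranch T z x) (H := H₁) ?_ ?_
        (h₁.conn.preconnected u z).some hu
      · intro s t hs hst ht
        exact ⟨(side₁ s t hst hs).resolve_left ht, .inl ⟨hst, .inl hs⟩⟩
      · intro s hs hst
        exact SimpleGraph.Adj.reachable (.inl ⟨hst, .inl hs⟩)
    · by_cases huz : u = z
      · subst huz
        exact .refl _
      refine reachable_of_walk (P := fun u => u ≠ z ∧ ¬ SameBranch T z x u) (H := H₂) ?_ ?_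
        (h₂.conn.preconnected u z).some ⟨huz, hu⟩
      · rintro s t ⟨hs, hs'⟩ hst ht
        have : ¬ SameBranch T z x t := fun h => hs' (h.trans (h₂.edge z hz s t hst hs ht).symm)
        exact ⟨⟨ht, this⟩, .inr ⟨hst, hs', this⟩⟩
      · rintro s ⟨hs, hs'⟩ hst
        exact SimpleGraph.Adj.reachable (.inr ⟨hst, hs', fun h => h.ne_right rfl⟩)
  · intro a ha u v h hu hv
    rcases h with ⟨h, -⟩ | ⟨h, -⟩
    · exact h₁.edge a ha u v h hu hv
    · exact h₂.edge a ha u v h hu hv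
  · intro a ha u v hu hv huv
    rcases hu with ⟨hu, hu'⟩ | ⟨hu, hu', hu''⟩ <;> rcases hv with ⟨hv, hv'⟩ | ⟨hv, hv', hv''⟩
    · exact h₁.nbr a ha u v hu hv huv
    · -- an edge of each kind at `a` forces `a = z`, and the two ends are in different branches
      exfalso
      have hux := hu'.resolve_left hv'
      have haz : a = z := ((side₁ u a hu.symm hux).resolve_right hv')
      subst haz
      exact hv'' (hux.trans huv)
    · exfalso
      have hvx := hv'.resolve_left hu'
      have haz : a = z := ((side₁ v a hv.symm hvx).resolve_right hu')
      subst haz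
      exact hu'' (hvx.trans huv.symm)
    · exact h₂.nbr a ha u v hu hv huv
  · intro v hv
    by_cases hvx : SameBranch T z x v
    · refine le_trans (Finset.card_le_card fun u hu => ?_) (h₁.deg v hv)
      rw [SimpleGraph.mem_neighborFinset] at hu ⊢
      rcases hu with ⟨hu, -⟩ | ⟨-, hu, -⟩
      · exact hu
      · exact absurd hvx hu
    · refine le_trans (Finset.card_le_card fun u hu => ?_) (h₂.deg v hv)
      rw [SimpleGraph.mem_neighborFinset] at hu ⊢
      rcases hu with ⟨hu, hu'⟩ | ⟨hu, -⟩
      · rcases side₁ u v hu.symm (hu'.resolve_left hvx) with rfl | h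
        · exact absurd hz hv
        · exact absurd h hvx
      · exact hu

theorem splice_degree_left (hx : SameBranch T z x u) {H₁ H₂ : SimpleGraph V} :
    (splice T z x H₁ H₂).degree u ≤ H₁.degree u := by
  refine Finset.card_le_card fun w hw => ?_
  rw [SimpleGraph.mem_neighborFinset] at hw ⊢
  rcases hw with ⟨hw, -⟩ | ⟨-, hw, -⟩
  · exact hw
  · exact absurd hx hw

theorem splice_degree_right {H₁ H₂ : SimpleGraph V} (h₁ : Respects G T k A H₁) (hz : z ∈ A)
    (huz : u ≠ z) (hx : ¬ SameBranch T z x u) :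
    (splice T z x H₁ H₂).degree u ≤ H₂.degree u := by
  refine Finset.card_le_card fun w hw => ?_
  rw [SimpleGraph.mem_neighborFinset] at hw ⊢
  rcases hw with ⟨hw, hw'⟩ | ⟨hw, -⟩
  · have := hw'.resolve_left hx
    exact absurd (this.trans (h₁.edge z hz u w hw huz this.ne_right).symm) hx
  · exact hw

/-- Removing the edge by which `H` enters the branch of `x` at `z` and adding an edge `xy` that
leaves this branch keeps `H` connected. -/
theorem Respects.exchange_connected (hH : Respects G T k A H) (hz : z ∈ A) (hxz : x ≠ z)
    (hyz : y ≠ z) (hsep : ¬ SameBranch T z x y) (hzw : H.Adj z w) (hw : SameBranch T z x w) :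
    (exchange H x y z w).Connected := by
  have hxy : x ≠ y := by
    rintro rfl
    exact hsep (.refl hxz)
  have hadj : ∀ {u v}, H.Adj u v → ¬ (u = z ∧ v = w) → ¬ (u = w ∧ v = z) →
      (exchange H x y z w).Adj u v := by
    intro u v h h1 h2
    rw [exchange_adj hxy hzw.ne]
    exact ⟨.inl h, fun h => h.elim h1 h2⟩
  have hout : ∀ u, ¬ SameBranch T z x u → (exchange H x y z w).Reachable u z := by
    intro u hu
    by_cases huz : u = z
    · subst huz
      exact .refl _
    refine reachable_of_walk (P := fun u => u ≠ z ∧ ¬ SameBranch T z x u) (H := H) ?_ ?_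
      (hH.conn.preconnected u z).some ⟨huz, hu⟩
    · rintro s t ⟨hs, hs'⟩ hst ht
      refine ⟨⟨ht, fun h => hs' (h.trans (hH.edge z hz s t hst hs ht).symm)⟩,
        hadj hst (fun h => hs h.1) (fun h => ht h.2)⟩
    · rintro s ⟨hs, hs'⟩ hst
      exact (hadj hst (fun h => hs h.1) (fun h => hs' (h.1 ▸ hw))).reachable
  have hin : ∀ u, SameBranch T z x u → (exchange H x y z w).Reachable u w := by
    intro u hu
    -- the walk is followed up to its last vertex before `z`, which is `w`
    have key : ∀ {s t : V} (_ : H.Walk s t), t = z → SameBranch T z x s →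
        (exchange H x y z w).Reachable s w := by
      intro s t p
      induction p with
      | nil => exact fun h hs => absurd h hs.ne_right
      | @cons s s' t hst p ih =>
        intro ht hs
        by_cases hs' : s' = z
        · subst hs'
          have : s = w := hH.nbr _ hz s w hst.symm hzw (hs.symm.trans hw)
          subst this
          exact .refl _
        · have hb := hH.edge z hz s s' hst hs.ne_right hs'
          exact (hadj hst (fun h => hs.ne_right h.1) (fun h => hs' h.2)).reachable.trans
            (ih ht (hs.trans hb))
    exact key (hH.conn.preconnected u z).some rfl hu
  have hxyadj : (exchange H x y z w).Adj x y := by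
    rw [exchange_adj hxy hzw.ne]
    exact ⟨.inr (.inl ⟨rfl, rfl⟩), fun h => h.elim (fun h => hxz h.1) (fun h => hyz h.2)⟩
  refine connected_of_reachable z fun u => ?_
  by_cases hu : SameBranch T z x u
  · exact (hin u hu).trans ((hin x (.refl hxz)).symm.trans (hxyadj.reachable.trans (hout y hsep)))
  · exact hout u hu

theorem exchange_degree_le (hxy : x ≠ y) (hzw : z ≠ w) (hx : v ≠ x) (hy : v ≠ y) :
    (exchange H x y z w).degree v ≤ H.degree v := by
  refine Finset.card_le_card fun u hu => ?_
  rw [SimpleGraph.mem_neighborFinset] at hu ⊢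
  rw [exchange_adj hxy hzw] at hu
  grind

theorem exchange_degree_le_add_one (hxy : x ≠ y) (hzw : z ≠ w) :
    (exchange H x y z w).degree v ≤ H.degree v + 1 := by
  by_cases hx : v = x
  · subst hx
    refine (Finset.card_le_card (t := insert y (H.neighborFinset v)) fun u hu => ?_).trans
      (Finset.card_insert_le _ _)
    rw [SimpleGraph.mem_neighborFinset, exchange_adj hxy hzw] at hu
    rw [Finset.mem_insert, SimpleGraph.mem_neighborFinset]
    grind
  by_cases hy : v = y
  · subst hy
    refine (Finset.card_le_card (t := insert x (H.neighborFinset v)) fun u hu => ?_).trans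
      (Finset.card_insert_le _ _)
    rw [SimpleGraph.mem_neighborFinset, exchange_adj hxy hzw] at hu
    rw [Finset.mem_insert, SimpleGraph.mem_neighborFinset]
    grind
  · exact (exchange_degree_le hxy hzw hx hy).trans (Nat.le_succ _)

theorem exchange_degree_lt (hxy : x ≠ y) (hzw : H.Adj z w) (hx : z ≠ x) (hy : z ≠ y) :
    (exchange H x y z w).degree z < H.degree z := by
  refine Finset.card_lt_card ⟨fun u hu => ?_, fun h => ?_⟩
  · rw [SimpleGraph.mem_neighborFinset] at hu ⊢
    rw [exchange_adj hxy hzw.ne] at hu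
    grind
  · have : w ∈ (exchange H x y z w).neighborFinset z :=
      h (by rw [SimpleGraph.mem_neighborFinset]; exact hzw)
    rw [SimpleGraph.mem_neighborFinset, exchange_adj hxy hzw.ne] at this
    exact this.2 (.inl ⟨rfl, rfl⟩)

omit [Fintype V] in
theorem exchange_le (hHG : H ≤ G) (hxy : G.Adj x y) : exchange H x y z w ≤ G := by
  refine sdiff_le.trans (sup_le hHG ?_)
  intro u v h
  rw [SimpleGraph.edge_adj] at h
  rcases h.1 with ⟨rfl, rfl⟩ | ⟨rfl, rfl⟩
  · exact hxy
  · exact hxy.symm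

/-- The exchanged graph respects all branches at those vertices of `A` that do not separate `x`
from `y`. -/
theorem Respects.exchange (hT : T.Connected) (hH : Respects G T k A H) (hz : z ∈ A) (hx : x ∉ A)
    (hy : y ∉ A) (hsep : ¬ SameBranch T z x y) (hzw : H.Adj z w)
    (hw : SameBranch T z x w) (hxy : G.Adj x y) (hdx : H.degree x < k) (hdy : H.degree y < k)
    (hdeg : ∀ a ∈ A, ¬ SameBranch T a x y → T.degree a ≤ k) :
    Respects G T k (A.filter fun a => SameBranch T a x y) (exchange H x y z w) := by
  have hne : ∀ a ∈ A, a ≠ x ∧ a ≠ y := fun a ha => ⟨fun h => hx (h ▸ ha), fun h => hy (h ▸ ha)⟩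
  have hxy' := hxy.ne
  refine ⟨exchange_le hH.le hxy,
    hH.exchange_connected hz (hne z hz).1.symm (hne z hz).2.symm hsep hzw hw, ?_, ?_, ?_⟩
  · intro a ha u v h hu hv
    rw [Finset.mem_filter] at ha
    rw [exchange_adj hxy' hzw.ne] at h
    rcases h.1 with h | ⟨rfl, rfl⟩ | ⟨rfl, rfl⟩
    · exact hH.edge a ha.1 u v h hu hv
    · exact ha.2
    · exact ha.2.symm
  · intro a ha u v hu hv
    rw [Finset.mem_filter] at ha
    rw [exchange_adj hxy' hzw.ne] at hu hv
    have := hne a ha.1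
    exact hH.nbr a ha.1 u v (by grind) (by grind)
  · intro v hv
    rw [Finset.mem_filter, not_and] at hv
    by_cases hvx : v = x
    · subst hvx
      exact (exchange_degree_le_add_one hxy' hzw.ne).trans hdx
    by_cases hvy : v = y
    · subst hvy
      exact (exchange_degree_le_add_one hxy' hzw.ne).trans hdy
    refine (exchange_degree_le hxy' hzw.ne hvx hvy).trans ?_
    by_cases hvA : v ∈ A
    · exact (hH.degree_le hT hvA).trans (hdeg v hvA (hv hvA))
    · exact hH.deg v hvA

end Exchange

/-! ### Optimal spanning trees -/

section Optimal

open Classical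

variable {V : Type*} [Fintype V] {G H T : SimpleGraph V} {k : ℕ}

/-- The total amount by which the degrees of `T` exceed `k`. -/
noncomputable def excess (T : SimpleGraph V) (k : ℕ) : ℕ := ∑ v, (T.degree v - k)

/-- The number of vertices of degree at least `k`. -/
noncomputable def saturation (T : SimpleGraph V) (k : ℕ) : ℕ :=
  (Finset.univ.filter fun v => k ≤ T.degree v).card

/-- `T` is a spanning tree of `G` of least excess and, subject to that, with the fewest vertices of
degree at least `k`. -/
structure IsOptimal (G T : SimpleGraph V) (k : ℕ) : Prop where
  le : T ≤ G
  isTree : T.IsTree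
  excess_le : ∀ T' ≤ G, T'.IsTree → excess T k ≤ excess T' k
  saturation_le : ∀ T' ≤ G, T'.IsTree → excess T' k ≤ excess T k →
    saturation T k ≤ saturation T' k

theorem exists_isOptimal (hG : G.Connected) (k : ℕ) : ∃ T, IsOptimal G T k := by
  obtain ⟨T₀, hle, hT₀⟩ := hG.exists_isTree_le
  let S : Finset (SimpleGraph V) := Finset.univ.filter fun T => T ≤ G ∧ T.IsTree
  obtain ⟨T₁, h₁, hmin₁⟩ := S.exists_min_image (excess · k) ⟨T₀, by simp [S, hle, hT₀]⟩
  obtain ⟨T, hT, hmin⟩ := (S.filter fun T => excess T k ≤ excess T₁ k).exists_min_image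
    (saturation · k) ⟨T₁, by simp [h₁]⟩
  simp only [S, Finset.mem_filter, Finset.mem_univ, true_and] at hT hmin hmin₁
  exact ⟨T, hT.1.1, hT.1.2, fun T' h h' => hT.2.trans (hmin₁ T' ⟨h, h'⟩),
    fun T' h h' h'' => hmin T' ⟨⟨h, h'⟩, h''.trans hT.2⟩⟩

theorem exists_lt_degree (hno : ¬ HasSpanningKTree G k) (hTG : T ≤ G) (hT : T.IsTree) :
    ∃ v, k < T.degree v := by
  by_contra! h
  refine hno ⟨T, hTG, hT, fun v => ?_⟩
  rw [← Nat.card_coe_set_eq, Nat.card_eq_fintype_card, SimpleGraph.card_neighborSet_eq_degree]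
  exact h v

theorem excess_mono {T' : SimpleGraph V} (h : ∀ v, T'.degree v ≤ k ∨ T'.degree v ≤ T.degree v) :
    excess T' k ≤ excess T k :=
  Finset.sum_le_sum fun v _ => by have := h v; omega

theorem excess_lt {T' : SimpleGraph V} (h : ∀ v, T'.degree v ≤ k ∨ T'.degree v ≤ T.degree v)
    {z : V} (hz : T'.degree z < T.degree z) (hk : k < T.degree z) :
    excess T' k < excess T k :=
  Finset.sum_lt_sum (fun v _ => by have := h v; omega) ⟨z, Finset.mem_univ _, by omega⟩

/-- Win's argument: an optimal spanning tree has a set `A` of vertices of degree at least `k`,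
containing all those of degree more than `k`, such that no edge of `G` between vertices outside `A`
joins different components of `T - A`. It is a minimal set for which the degree of every vertex
outside can be brought below `k` by a graph respecting the branches at `A`: an edge of `G` between
two components would allow the degrees of all vertices of `A` between its ends to be lowered. -/
theorem IsOptimal.exists_saturated (hT : IsOptimal G T k) :
    ∃ A : Finset V, (∀ a ∈ A, k ≤ T.degree a) ∧ (∀ v, k < T.degree v → v ∈ A) ∧
      ∀ x y, x ∉ A → y ∉ A → G.Adj x y → ∀ a ∈ A, SameBranch T a x y := by
  have hconn := hT.isTree.connected
  let Q : Finset V → Prop := fun A => (∀ a ∈ A, k ≤ T.degree a) ∧ (∀ v, k < T.degree v → v ∈ A) ∧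
    ∀ x, x ∉ A → ∃ H, Respects G T k A H ∧ H.degree x < k
  have hQ : Q (Finset.univ.filter fun v => k ≤ T.degree v) := by
    refine ⟨by simp, fun v hv => by simpa using hv.le, fun x hx => ⟨T, ?_, by simpa using hx⟩⟩
    exact respects_self hT.le hT.isTree fun v hv => by
      simp only [Finset.mem_filter, Finset.mem_univ, true_and, not_le] at hv
      exact hv.le
  obtain ⟨A, hA, hmin⟩ := (Finset.univ.filter Q).exists_min_image Finset.card ⟨_, by simpa using hQ⟩
  simp only [Finset.mem_filter, Finset.mem_univ, true_and] at hA hmin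
  obtain ⟨hAk, hAe, hAred⟩ := hA
  refine ⟨A, hAk, hAe, fun x y hx hy hxy z hz => ?_⟩
  by_contra hsep
  have hne : ∀ a ∈ A, a ≠ x ∧ a ≠ y := fun a ha => ⟨fun h => hx (h ▸ ha), fun h => hy (h ▸ ha)⟩
  obtain ⟨H₁, h₁, hd₁⟩ := hAred x hx
  obtain ⟨H₂, h₂, hd₂⟩ := hAred y hy
  -- one graph lowers the degrees of both ends, since `z` separates them
  obtain ⟨H, hH, hdx, hdy⟩ : ∃ H, Respects G T k A H ∧ H.degree x < k ∧ H.degree y < k :=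
    ⟨splice T z x H₁ H₂, h₁.splice h₂ hz,
      (splice_degree_left (.refl (hne z hz).1.symm)).trans_lt hd₁,
      (splice_degree_right h₁ hz (hne z hz).2.symm hsep).trans_lt hd₂⟩
  have hentry : ∀ a ∈ A, ∃ w, H.Adj a w ∧ SameBranch T a x w := by
    intro a ha
    obtain ⟨w, hw, p, hp⟩ := exists_adj_sameBranch hH.conn (hne a ha).1.symm
    refine ⟨w, hw, ?_⟩
    clear hw hd₁ hd₂ hdx hdy hxy hsep
    have key : ∀ {s t : V} (p : H.Walk s t), a ∉ p.support → SameBranch T a s t := by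
      intro s t p
      induction p with
      | nil => exact fun h => .refl (by simpa using (Ne.symm (by simpa using h)))
      | @cons s s' t hst p ih =>
        intro h
        rw [SimpleGraph.Walk.support_cons, List.mem_cons, not_or] at h
        have hs' : s' ≠ a := fun h' => h.2 (h' ▸ p.start_mem_support)
        exact (hH.edge a ha s s' hst (Ne.symm h.1) hs').trans (ih h.2)
    exact key p hp
  have hdeg : ∀ a ∈ A, ¬ SameBranch T a x y → T.degree a ≤ k := by
    intro a ha hsepa
    by_contra! hka
    obtain ⟨w, hw, hxw⟩ := hentry a ha
    obtain ⟨T', hle, hT'⟩ := (hH.exchange_connected ha (hne a ha).1.symm (hne a ha).2.symm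
      hsepa hw hxw).exists_isTree_le
    refine (hT.excess_le T' (hle.trans (exchange_le hH.le hxy)) hT').not_gt
      (excess_lt (z := a) (fun v => ?_) ?_ hka)
    · have hv := SimpleGraph.degree_le_of_le hle (v := v)
      by_cases hvA : v ∈ A
      · exact .inr (hv.trans ((exchange_degree_le hxy.ne hw.ne (hne v hvA).1 (hne v hvA).2).trans
          (hH.degree_le hconn hvA)))
      · left
        by_cases hvx : v = x
        · subst hvx
          exact hv.trans ((exchange_degree_le_add_one hxy.ne hw.ne).trans hdx)
        by_cases hvy : v = y
        · subst hvy
          exact hv.trans ((exchange_degree_le_add_one hxy.ne hw.ne).trans hdy)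
        exact hv.trans ((exchange_degree_le hxy.ne hw.ne hvx hvy).trans (hH.deg v hvA))
    · exact (SimpleGraph.degree_le_of_le hle).trans_lt
        ((exchange_degree_lt hxy.ne hw (hne a ha).1 (hne a ha).2).trans_le (hH.degree_le hconn ha))
  -- the vertices of `A` that separate `x` from `y` can be discarded
  have hlt : (A.filter fun a => SameBranch T a x y).card < A.card :=
    Finset.card_lt_card (Finset.filter_ssubset.2 ⟨z, hz, hsep⟩)
  refine hlt.not_ge (hmin _ ⟨fun a ha => hAk a (Finset.mem_filter.1 ha).1, fun v hv => ?_,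
    fun u hu => ?_⟩)
  · refine Finset.mem_filter.2 ⟨hAe v hv, ?_⟩
    by_contra h
    exact (hdeg v (hAe v hv) h).not_gt hv
  · by_cases huA : u ∈ A
    · have husep : ¬ SameBranch T u x y := fun h => hu (Finset.mem_filter.2 ⟨huA, h⟩)
      obtain ⟨w, hw, hxw⟩ := hentry u huA
      refine ⟨_, hH.exchange hconn huA hx hy husep hw hxw hxy hdx hdy hdeg, ?_⟩
      exact (exchange_degree_lt hxy.ne hw (hne u huA).1 (hne u huA).2).trans_le
        ((hH.degree_le hconn huA).trans (hdeg u huA husep))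
    · obtain ⟨H', hH', hd'⟩ := hAred u huA
      refine ⟨H', hH'.mono hconn (Finset.filter_subset _ _) fun v hv hv' => ?_, hd'⟩
      exact hdeg v hv fun h => hv' (Finset.mem_filter.2 ⟨hv, h⟩)

end Optimal

/-! ### Counting in forests -/

section Structure

open Classical

variable {V : Type*} {G H T : SimpleGraph V} {k : ℕ}

theorem induce_degree [Fintype V] (F : SimpleGraph V) (s : Set V)
    [DecidablePred (· ∈ s)] (v : s)
    [Fintype ((F.induce s).neighborSet v)] :
    (F.induce s).degree v = ((F.neighborFinset v).filter (· ∈ s)).card := by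
  rw [← SimpleGraph.card_neighborFinset_eq_degree,
    ← Finset.card_map (Function.Embedding.subtype (· ∈ s))]
  congr 1
  ext u
  simp only [Finset.mem_map, SimpleGraph.mem_neighborFinset, Finset.mem_filter,
    Function.Embedding.subtype_apply, SimpleGraph.comap_adj, Subtype.exists, exists_and_left,
    exists_prop, exists_eq_right_right]

theorem sum_induce_degree [Fintype V] (F : SimpleGraph V) (s : Set V) (A : Finset V)
    (hA : ∀ v, v ∈ A ↔ v ∈ s) [DecidablePred (· ∈ s)] [Fintype s]
    [∀ v, Fintype ((F.induce s).neighborSet v)] :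
    ∑ v : s, (F.induce s).degree v =
      ∑ v ∈ A, ((F.neighborFinset v).filter (· ∈ s)).card := by
  rw [Finset.sum_subtype A hA]
  exact Finset.sum_congr rfl fun v _ => induce_degree F s v

/-- A forest with `c` components has `|W| - c` edges. -/
theorem sum_degree_add_card_components {W : Type*} [Fintype W] {F : SimpleGraph W}
    [∀ v, Fintype (F.neighborSet v)] (hF : F.IsAcyclic) :
    ∑ v, F.degree v + 2 * Nat.card F.ConnectedComponent = 2 * Fintype.card W := by
  have hC : ∀ C : F.ConnectedComponent,
      ∑ v with F.connectedComponentMk v = C, F.degree v + 2 =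
        2 * (Finset.univ.filter fun v => F.connectedComponentMk v = C).card := by
    intro C
    have : Fintype C.supp := Fintype.ofFinite _
    have htree : (F.induce C.supp).IsTree := hF.isTree_connectedComponent C
    have h1 := htree.card_edgeFinset
    have h2 : ∑ v : C.supp, (F.induce C.supp).degree v =
        2 * (F.induce C.supp).edgeFinset.card :=
      (F.induce C.supp).sum_degrees_eq_twice_card_edges
    have h3 : ∑ v : C.supp, (F.induce C.supp).degree v =
        ∑ v with F.connectedComponentMk v = C, F.degree v := by
      rw [sum_induce_degree F C.supp (Finset.univ.filter fun v => F.connectedComponentMk v = C)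
        (by simp)]
      refine Finset.sum_congr rfl fun v hv => ?_
      rw [← SimpleGraph.card_neighborFinset_eq_degree, Finset.filter_true_of_mem]
      · congr!
      intro u hu
      have hadj : F.Adj v u := by simpa using hu
      have hv : F.connectedComponentMk v = C := (Finset.mem_filter.1 hv).2
      change F.connectedComponentMk u = C
      rw [← hv]
      exact SimpleGraph.ConnectedComponent.sound hadj.symm.reachable
    have h4 : Fintype.card C.supp =
        (Finset.univ.filter fun v => F.connectedComponentMk v = C).card := by
      exact Fintype.card_of_subtype _ (by simp)
    rw [← h3, h2, ← h4, ← h1]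
    ring
  have hsum := Finset.sum_congr rfl fun C (_ : C ∈ Finset.univ) => hC C
  rw [Finset.sum_add_distrib, ← Finset.mul_sum,
    Finset.sum_fiberwise Finset.univ F.connectedComponentMk (fun v => F.degree v),
    ← Finset.card_eq_sum_card_fiberwise (f := F.connectedComponentMk) (t := Finset.univ)
      (fun _ _ => Finset.mem_coe.2 (Finset.mem_univ _)),
    Finset.sum_const, Finset.card_univ, smul_eq_mul, Finset.card_univ] at hsum
  rw [Nat.card_eq_fintype_card]
  linarith

variable [Fintype V]

theorem card_compl_coe (S : Finset V) :
    Fintype.card ((S : Set V)ᶜ : Set V) + S.card = Fintype.card V := by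
  rw [Fintype.card_of_subtype Sᶜ (by simp), add_comm, Finset.card_add_card_compl]

/-- Double counting of the edges between a set and its complement. -/
theorem sum_filter_notMem_eq [∀ v, Fintype (G.neighborSet v)] (S : Finset V) :
    ∑ v ∈ S, ((G.neighborFinset v).filter (· ∉ S)).card =
      ∑ v ∈ Sᶜ, ((G.neighborFinset v).filter (· ∈ S)).card := by
  have := Finset.sum_card_bipartiteAbove_eq_sum_card_bipartiteBelow (s := S) (t := Sᶜ) G.Adj
  convert this using 2
  · congr 1
    ext u
    simp [Finset.bipartiteAbove, and_comm]
  · congr 1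
    ext u
    simp [Finset.bipartiteBelow, and_comm, G.adj_comm]

/-- Deleting a set `A` from a tree, the number of components grows with the degrees in `A` and with
the number of components of the subforest on `A`. -/
theorem compCount_of_isTree (hT : T.IsTree) (A : Finset V) :
    compCount T A + 2 * A.card =
      ∑ v ∈ A, T.degree v + Nat.card (T.induce (A : Set V)).ConnectedComponent + 1 := by
  have h0 := hT.card_edgeFinset
  have h0' := T.sum_degrees_eq_twice_card_edges
  have h1 := sum_degree_add_card_components (hT.isAcyclic.induce (A : Set V))
  have h2 := sum_degree_add_card_components (hT.isAcyclic.induce (A : Set V)ᶜ)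
  rw [sum_induce_degree T _ A (by simp)] at h1
  rw [sum_induce_degree T _ Aᶜ (by simp)] at h2
  have hsplit : ∀ v, T.degree v = ((T.neighborFinset v).filter (· ∈ A)).card +
      ((T.neighborFinset v).filter (· ∉ A)).card := fun v => by
    rw [Finset.card_filter_add_card_filter_not, SimpleGraph.card_neighborFinset_eq_degree]
  have hdouble := sum_filter_notMem_eq (G := T) A
  have hA : ∑ v ∈ A, T.degree v = ∑ v ∈ A, ((T.neighborFinset v).filter (· ∈ A)).card +
      ∑ v ∈ A, ((T.neighborFinset v).filter (· ∉ A)).card := by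
    rw [← Finset.sum_add_distrib]
    exact Finset.sum_congr rfl fun v _ => hsplit v
  have hAc : ∑ v ∈ Aᶜ, T.degree v = ∑ v ∈ Aᶜ, ((T.neighborFinset v).filter (· ∈ A)).card +
      ∑ v ∈ Aᶜ, ((T.neighborFinset v).filter (· ∉ A)).card := by
    rw [← Finset.sum_add_distrib]
    exact Finset.sum_congr rfl fun v _ => hsplit v
  have htot := Finset.sum_add_sum_compl A fun v => T.degree v
  have c1 : Fintype.card (A : Set V) = A.card := by simp
  have c2 := card_compl_coe A
  unfold compCount
  simp only [Finset.mem_coe, Set.mem_compl_iff] at h1 h2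
  omega

end Structure

/-! ### The obstruction to spanning `k`-trees -/

section Obstruction

open Classical

variable {V : Type*} [Fintype V] {G T : SimpleGraph V} {k : ℕ} {A : Finset V} {u v x : V}

/-- If `v u` is an edge of an optimal tree whose end `u` is saturated, then `v` has no neighbour `x`
of degree at most `k - 2` in the branch of `u` at `v`: replacing `v u` by `v x` would improve
the tree. -/
theorem IsOptimal.not_sameBranch (hT : IsOptimal G T k) (hvu : T.Adj v u) (hu : k ≤ T.degree u)
    (hx : T.degree x + 2 ≤ k) (hvx : G.Adj v x) : ¬ SameBranch T v x u := by
  intro hxu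
  have hconn := hT.isTree.connected
  have hne : x ≠ u := by
    rintro rfl
    omega
  set K : SimpleGraph V := (T \ SimpleGraph.edge v u) ⊔ SimpleGraph.edge v x with hK
  have hadj : ∀ {s t}, K.Adj s t ↔ (T.Adj s t ∧ ¬ ((s = v ∧ t = u) ∨ (s = u ∧ t = v))) ∨
      ((s = v ∧ t = x) ∨ (s = x ∧ t = v)) := by
    intro s t
    have := hvx.ne
    have := hvu.ne
    simp only [hK, SimpleGraph.sup_adj, SimpleGraph.sdiff_adj, SimpleGraph.edge_adj]
    grind
  have hin : ∀ s t, SameBranch T v s t → K.Reachable s t := by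
    rintro s t ⟨p, hp⟩
    induction p with
    | nil => exact .refl _
    | @cons s s' t hst p ih =>
      rw [SimpleGraph.Walk.support_cons, List.mem_cons, not_or] at hp
      have hs' : s' ≠ v := fun h => hp.2 (h ▸ p.start_mem_support)
      exact (hadj.2 (.inl ⟨hst, by grind⟩)).reachable.trans (ih hp.2)
  have hKconn : K.Connected := by
    refine connected_of_reachable v fun s => ?_
    by_cases hs : s = v
    · subst hs
      exact .refl _
    obtain ⟨w, hw, hsw⟩ := exists_adj_sameBranch hconn hs
    by_cases hwu : w = u
    · subst hwu
      exact (hin s x (hsw.trans hxu.symm)).trans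
        (SimpleGraph.Adj.reachable (hadj.2 (.inr (.inr ⟨rfl, rfl⟩))))
    · exact (hin s w hsw).trans
        (SimpleGraph.Adj.reachable (hadj.2 (.inl ⟨hw.symm, by grind⟩)))
  have hKG : K ≤ G := by
    intro s t h
    rcases hadj.1 h with ⟨h, -⟩ | ⟨rfl, rfl⟩ | ⟨rfl, rfl⟩
    · exact hT.le h
    · exact hvx
    · exact hvx.symm
  have hdx : K.degree x ≤ T.degree x + 1 := by
    refine (Finset.card_le_card (t := insert v (T.neighborFinset x)) fun s hs => ?_).trans
      (Finset.card_insert_le _ _)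
    rw [SimpleGraph.mem_neighborFinset, hadj] at hs
    rw [Finset.mem_insert, SimpleGraph.mem_neighborFinset]
    grind
  have hdu : K.degree u < T.degree u := by
    refine Finset.card_lt_card ⟨fun s hs => ?_, fun h => ?_⟩
    · rw [SimpleGraph.mem_neighborFinset, hadj] at hs
      rw [SimpleGraph.mem_neighborFinset]
      have := hvu.ne
      grind
    · have hv : v ∈ K.neighborFinset u :=
        h (by rw [SimpleGraph.mem_neighborFinset]; exact hvu.symm)
      rw [SimpleGraph.mem_neighborFinset, hadj] at hv
      have := hvu.ne
      grind
  have hdv : K.degree v ≤ T.degree v := by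
    have h1 : K.neighborFinset v ⊆ insert x ((T.neighborFinset v).erase u) := by
      intro s hs
      rw [SimpleGraph.mem_neighborFinset, hadj] at hs
      rw [Finset.mem_insert, Finset.mem_erase, SimpleGraph.mem_neighborFinset]
      have := hvx.ne
      grind
    have h2 : u ∈ T.neighborFinset v := by rwa [SimpleGraph.mem_neighborFinset]
    calc K.degree v ≤ _ := Finset.card_le_card h1
      _ ≤ ((T.neighborFinset v).erase u).card + 1 := Finset.card_insert_le _ _
      _ = T.degree v := Finset.card_erase_add_one h2
  have hd : ∀ s, s ≠ x → K.degree s ≤ T.degree s := by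
    intro s hs
    by_cases hsv : s = v
    · exact hsv ▸ hdv
    refine Finset.card_le_card fun w hw => ?_
    rw [SimpleGraph.mem_neighborFinset, hadj] at hw
    rw [SimpleGraph.mem_neighborFinset]
    grind
  obtain ⟨T', hle, hT'⟩ := hKconn.exists_isTree_le
  have hdT' : ∀ s, T'.degree s ≤ K.degree s := fun s => SimpleGraph.degree_le_of_le hle
  have hbound : ∀ s, T'.degree s ≤ k ∨ T'.degree s ≤ T.degree s := by
    intro s
    have h := hdT' s
    by_cases hs : s = x
    · subst hs
      left
      omega
    · exact .inr (h.trans (hd s hs))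
  have hu' := (hdT' u).trans_lt hdu
  by_cases huk : k < T.degree u
  · exact (hT.excess_le T' (hle.trans hKG) hT').not_gt (excess_lt hbound hu' huk)
  · refine (hT.saturation_le T' (hle.trans hKG) hT' (excess_mono hbound)).not_gt
      (Finset.card_lt_card ⟨fun s hs => ?_, fun h => ?_⟩)
    · simp only [Finset.mem_filter, Finset.mem_univ, true_and] at hs ⊢
      have h := hdT' s
      by_cases hsx : s = x
      · subst hsx
        omega
      · exact hs.trans (h.trans (hd s hsx))
    · have := h (x := u) (by simpa using hu)
      simp only [Finset.mem_filter, Finset.mem_univ, true_and] at this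
      omega

omit [Fintype V] in
theorem SameBranch.of_walk_induce {s : Set V} {a : V} {v v' : s} (p : (T.induce s).Walk v v')
    (h : ∀ w ∈ p.support, (w : V) ≠ a) : SameBranch T a v v' := by
  induction p with
  | nil => exact .refl (h _ (by simp))
  | @cons v w v' hadj p ih =>
    simp only [SimpleGraph.Walk.support_cons, List.mem_cons, forall_eq_or_imp] at h
    exact (SameBranch.of_adj (T := T) hadj h.1 (h.2 w p.start_mem_support)).trans (ih h.2)

omit [Fintype V] in
/-- In the subgraph induced on `s`, a path from `v` to `v'` leaves `v` by an edge into the branch of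
`v'` at `v`. -/
theorem exists_adj_mem_of_reachable_induce {s : Set V} {v v' : s} (hne : v ≠ v')
    (h : (T.induce s).Reachable v v') :
    ∃ u ∈ s, T.Adj v u ∧ SameBranch T (v : V) u v' := by
  obtain ⟨p, hp⟩ := h.exists_isPath
  cases p with
  | nil => exact absurd rfl hne
  | @cons _ w _ hadj q =>
    rw [SimpleGraph.Walk.cons_isPath_iff] at hp
    refine ⟨w, w.2, hadj, .of_walk_induce q fun w' hw' hw => hp.2 ?_⟩
    have : w' = v := Subtype.ext hw
    exact this ▸ hw'

/-- A vertex of degree at most `k - 2` in an optimal tree is adjacent in `G` to at most one vertex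
of each component of the subforest on a saturated set `A`. -/
theorem IsOptimal.eq_of_adj (hT : IsOptimal G T k) (hA : ∀ a ∈ A, k ≤ T.degree a)
    (hx : T.degree x + 2 ≤ k) (v v' : (A : Set V)) (hv : G.Adj v x) (hv' : G.Adj v' x)
    (h : (T.induce (A : Set V)).Reachable v v') : v = v' := by
  by_contra hne
  obtain ⟨u, hu, hvu, huv⟩ := exists_adj_mem_of_reachable_induce hne h
  obtain ⟨u', hu', hvu', huv'⟩ := exists_adj_mem_of_reachable_induce (Ne.symm hne) h.symm
  have h1 := hT.not_sameBranch hvu (hA u hu) hx hv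
  have h2 := hT.not_sameBranch hvu' (hA u' hu') hx hv'
  have hne' : (v : V) ≠ v' := fun h => hne (Subtype.ext h)
  -- if the path from `x` to `v'` meets `v`, then `x` is in the branch of `u'` at `v'`, and
  -- otherwise in the branch of `u` at `v`
  obtain ⟨p, hp⟩ := (hT.isTree.connected.preconnected x v').exists_isPath
  by_cases hvp : (v : V) ∈ p.support
  · refine h2 (SameBranch.trans ⟨p.takeUntil v hvp, ?_⟩ huv'.symm)
    exact SimpleGraph.Walk.endpoint_notMem_support_takeUntil hp hvp hne'.symm
  · exact h1 (SameBranch.trans ⟨p, hvp⟩ huv.symm)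

/-- In a tree, distinct neighbours of a vertex `x` outside `A` lie in distinct components of the
subforest on `A`. -/
theorem degree_le_card_components (hT : T.IsTree) (hx : x ∉ A) (h : ∀ y, T.Adj x y → y ∈ A) :
    T.degree x ≤ Nat.card (T.induce (A : Set V)).ConnectedComponent := by
  rw [← SimpleGraph.card_neighborSet_eq_degree, ← Nat.card_eq_fintype_card]
  refine Nat.card_le_card_of_injective (fun y : T.neighborSet x =>
    (T.induce (A : Set V)).connectedComponentMk ⟨y, h y y.2⟩) fun y y' hyy => ?_
  obtain ⟨p⟩ := SimpleGraph.ConnectedComponent.exact hyy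
  exact Subtype.ext (sameBranch_eq_of_adj hT y.2 y'.2
    (SameBranch.of_walk_induce (a := x) (v := ⟨y, h y y.2⟩) (v' := ⟨y', h y' y'.2⟩) p
      fun w _ hw => hx (by simpa [hw] using w.2)))

/-- If no edge of `G` outside `A` joins two components of `T - A`, then `G - A` and `T - A` have
the same components. -/
theorem compCount_le_of_sameBranch (hTG : T ≤ G) (hT : T.IsTree)
    (h : ∀ x y, x ∉ A → y ∉ A → G.Adj x y → ∀ a ∈ A, SameBranch T a x y) :
    compCount T A ≤ compCount G A := by
  have hadj : ∀ x y : ((A : Set V)ᶜ : Set V), (G.induce (A : Set V)ᶜ).Adj x y →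
      (T.induce (A : Set V)ᶜ).Reachable x y := by
    intro x y hxy
    obtain ⟨p, hp⟩ := (hT.connected.preconnected (x : V) y).exists_isPath
    refine ⟨p.induce (A : Set V)ᶜ fun a ha haA => ?_⟩
    obtain ⟨q, hq⟩ := h x y x.2 y.2 hxy a haA
    have : q.bypass = p := (hT.existsUnique_path _ _).unique q.bypass_isPath hp
    exact hq (q.support_bypass_subset_support (this ▸ ha))
  have hreach : ∀ x y : ((A : Set V)ᶜ : Set V), (G.induce (A : Set V)ᶜ).Reachable x y →
      (T.induce (A : Set V)ᶜ).Reachable x y := by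
    rintro x y ⟨p⟩
    induction p with
    | nil => exact .refl _
    | cons hst _ ih => exact (hadj _ _ hst).trans ih
  refine Nat.card_le_card_of_injective
    (SimpleGraph.ConnectedComponent.map (SimpleGraph.Hom.ofLE
      (show T.induce (A : Set V)ᶜ ≤ G.induce (A : Set V)ᶜ from fun _ _ h => hTG h))) ?_
  intro C D
  refine SimpleGraph.ConnectedComponent.ind₂ (fun x y hxy => ?_) C D
  exact SimpleGraph.ConnectedComponent.sound
    (hreach x y (SimpleGraph.ConnectedComponent.exact hxy))

/-- A sharpening of Win's theorem. A connected graph without spanning `k`-tree has a set `S` whose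
removal leaves at least `(k - 2)|S| + 2 + f` components, where `f ≥ 1`, such that all vertices
outside `S`, except for those of a small set `H`, have at most `f` neighbours in `S`. Here `f` is
the number of components of the forest that an optimal tree induces on `S`, and `H` consists of the
vertices outside `S` with degree at least `k - 1` in that tree. -/
theorem exists_obstruction (hk : 3 ≤ k) (hG : G.Connected) (hno : ¬ HasSpanningKTree G k) :
    ∃ (S H : Finset V) (f : ℕ), 1 ≤ f ∧ (k - 2) * S.card + 2 + f ≤ compCount G S ∧
      Disjoint S H ∧ (k - 2) * H.card + (k - 1) * S.card + 3 ≤ Fintype.card V ∧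
      (∀ x, x ∉ S → x ∉ H → ((G.neighborFinset x).filter (· ∈ S)).card ≤ f) ∧
      (∀ x ∈ H, (∀ y, G.Adj x y → y ∈ S) → 2 ≤ f) := by
  obtain ⟨T, hT⟩ := exists_isOptimal hG k
  obtain ⟨z, hz⟩ := exists_lt_degree hno hT.le hT.isTree
  obtain ⟨S, hS, hSe, hbr⟩ := hT.exists_saturated
  have hzS := hSe z hz
  set f := Nat.card (T.induce (S : Set V)).ConnectedComponent with hf
  set H : Finset V := Finset.univ.filter fun x => x ∉ S ∧ k ≤ T.degree x + 1 with hH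
  have hcount := compCount_of_isTree hT.isTree S
  have hle := compCount_le_of_sameBranch hT.le hT.isTree hbr
  have hdegS : k * S.card + 1 ≤ ∑ v ∈ S, T.degree v := by
    have := Finset.sum_lt_sum (f := fun _ : V => k) hS ⟨z, hzS, hz⟩
    rw [Finset.sum_const, smul_eq_mul, mul_comm] at this
    exact this
  have hdisj : Disjoint S H := by
    rw [Finset.disjoint_left]
    intro a ha ha'
    exact (Finset.mem_filter.1 ha').2.1 ha
  obtain ⟨j, rfl⟩ : ∃ j, k = j + 2 := ⟨k - 2, by omega⟩
  refine ⟨S, H, f, ?_, ?_, hdisj, ?_, ?_, ?_⟩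
  · have : Nonempty (T.induce (S : Set V)).ConnectedComponent :=
      ⟨(T.induce (S : Set V)).connectedComponentMk ⟨z, hzS⟩⟩
    exact Nat.card_pos
  · rw [add_mul] at hdegS
    simp only [Nat.add_sub_cancel]
    omega
  · -- the degrees are at least `k` on `S`, at least `k - 1` on `H` and positive elsewhere
    have hsum := T.sum_degrees_eq_twice_card_edges
    have hcard := hT.isTree.card_edgeFinset
    have hpos : ∀ v, 1 ≤ T.degree v := fun v => by
      have : Nontrivial V := by
        by_contra h
        rw [not_nontrivial_iff_subsingleton] at h
        have := SimpleGraph.degree_eq_zero_of_subsingleton (G := T) z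
        omega
      exact hT.isTree.connected.preconnected.degree_pos_of_nontrivial v
    have hU : (j + 1) * H.card ≤ ∑ v ∈ H, T.degree v := by
      rw [mul_comm, ← smul_eq_mul, ← Finset.sum_const]
      refine Finset.sum_le_sum fun v hv => ?_
      have := (Finset.mem_filter.1 hv).2.2
      omega
    have hrest : (Finset.univ \ (S ∪ H)).card ≤ ∑ v ∈ Finset.univ \ (S ∪ H), T.degree v := by
      rw [Finset.card_eq_sum_ones]
      exact Finset.sum_le_sum fun v _ => hpos v
    have h1 := Finset.sum_sdiff (Finset.subset_univ (S ∪ H)) (f := fun v => T.degree v)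
    have h2 := Finset.card_sdiff_add_card_eq_card (Finset.subset_univ (S ∪ H))
    rw [Finset.sum_union hdisj] at h1
    rw [Finset.card_union_of_disjoint hdisj, Finset.card_univ] at h2
    simp only [Nat.add_sub_cancel, show j + 2 - 1 = j + 1 from rfl]
    rw [add_mul] at hdegS hU ⊢
    omega
  · intro x hxS hxH
    have hx : T.degree x + 2 ≤ j + 2 := by
      by_contra h
      exact hxH (Finset.mem_filter.2 ⟨Finset.mem_univ _, hxS, by omega⟩)
    rw [← Fintype.card_coe, ← Nat.card_eq_fintype_card]
    have hmem : ∀ v : ((G.neighborFinset x).filter (· ∈ S)), G.Adj v x ∧ (v : V) ∈ S := by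
      intro v
      have := v.2
      rw [Finset.mem_filter, SimpleGraph.mem_neighborFinset] at this
      exact ⟨this.1.symm, this.2⟩
    refine Nat.card_le_card_of_injective (fun v =>
      (T.induce (S : Set V)).connectedComponentMk ⟨v, (hmem v).2⟩) fun v v' hvv => ?_
    have := hT.eq_of_adj hS hx _ _ (hmem v).1 (hmem v').1 (SimpleGraph.ConnectedComponent.exact hvv)
    exact Subtype.ext (congrArg (fun a : (S : Set V) => (a : V)) this)
  · intro x hx hy
    have hx' := (Finset.mem_filter.1 hx).2
    have := degree_le_card_components hT.isTree hx'.1 fun y hxy => hy y (hT.le hxy)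
    omega

end Obstruction

/-! ### Bounds on the spectral radius -/

section Spectral

open Classical

variable {V : Type*} [Fintype V] {G : SimpleGraph V}

/-- The square of an eigenvalue is at most the largest row sum of the squared adjacency matrix. -/
theorem sq_le_of_hasEigenvalue {μ B : ℝ}
    (hμ : Module.End.HasEigenvalue (Matrix.toLin' (G.adjMatrix ℝ)) μ)
    (hB : ∀ v, ((∑ u ∈ G.neighborFinset v, G.degree u : ℕ) : ℝ) ≤ B) : μ ^ 2 ≤ B := by
  obtain ⟨x, hx⟩ := hμ.exists_hasEigenvector
  have hx0 := hx.2
  have hAx : ∀ v, ∑ u ∈ G.neighborFinset v, x u = μ * x v := fun v => by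
    have := congrFun hx.apply_eq_smul v
    rwa [Matrix.toLin'_apply, SimpleGraph.adjMatrix_mulVec_apply, Pi.smul_apply,
      smul_eq_mul] at this
  -- the row sum is taken at an entry of largest absolute value
  obtain ⟨w, hw⟩ := Function.ne_iff.1 hx0
  obtain ⟨v, -, hv⟩ := Finset.exists_max_image Finset.univ (fun v => |x v|) ⟨w, Finset.mem_univ _⟩
  have hpos : 0 < |x v| := (abs_pos.2 hw).trans_le (hv w (Finset.mem_univ _))
  have habs : ∀ u, |μ * x u| ≤ G.degree u * |x v| := fun u => by
    rw [← hAx u]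
    refine (Finset.abs_sum_le_sum_abs _ _).trans ?_
    refine (Finset.sum_le_sum fun t _ => hv t (Finset.mem_univ _)).trans ?_
    rw [Finset.sum_const, nsmul_eq_mul, SimpleGraph.card_neighborFinset_eq_degree]
  have hsq : μ ^ 2 * x v = ∑ u ∈ G.neighborFinset v, μ * x u := by
    rw [← Finset.mul_sum, hAx]
    ring
  have : μ ^ 2 * |x v| ≤ B * |x v| := by
    calc μ ^ 2 * |x v| = |μ ^ 2 * x v| := by rw [abs_mul, abs_of_nonneg (sq_nonneg μ)]
      _ ≤ ∑ u ∈ G.neighborFinset v, |μ * x u| := by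
        rw [hsq]
        exact Finset.abs_sum_le_sum_abs _ _
      _ ≤ ∑ u ∈ G.neighborFinset v, G.degree u * |x v| := Finset.sum_le_sum fun u _ => habs u
      _ = ((∑ u ∈ G.neighborFinset v, G.degree u : ℕ) : ℝ) * |x v| := by
        rw [← Finset.sum_mul]
        push_cast
        rfl
      _ ≤ B * |x v| := mul_le_mul_of_nonneg_right (hB v) hpos.le
  exact le_of_mul_le_mul_right this hpos

theorem specRadius_le_sqrt {B : ℝ}
    (hB : ∀ v, ((∑ u ∈ G.neighborFinset v, G.degree u : ℕ) : ℝ) ≤ B) :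
    specRadius G ≤ √B :=
  Real.sSup_le (fun _ hμ => Real.le_sqrt_of_sq_le (sq_le_of_hasEigenvalue hμ hB))
    (Real.sqrt_nonneg _)

theorem le_specRadius_of_hasEigenvalue {μ : ℝ}
    (hμ : Module.End.HasEigenvalue (Matrix.toLin' (G.adjMatrix ℝ)) μ) : μ ≤ specRadius G := by
  refine le_csSup ⟨√((∑ u, G.degree u : ℕ) : ℝ), fun ν hν => ?_⟩ hμ
  refine Real.le_sqrt_of_sq_le (sq_le_of_hasEigenvalue hν fun v => ?_)
  exact_mod_cast Finset.sum_le_sum_of_subset (Finset.subset_univ _)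

/-- The spectral radius is at least that of any complete subgraph: otherwise, with `q` the latter,
`q - A` would be positive definite, but its quadratic form vanishes at the indicator vector of the
subgraph. -/
theorem card_sub_one_le_specRadius {K : Finset V} (hK : G.IsClique K) (hne : K.Nonempty) :
    (K.card : ℝ) - 1 ≤ specRadius G := by
  by_contra! hlt
  set q : ℝ := (K.card : ℝ) - 1 with hq
  set M : Matrix V V ℝ := q • (1 : Matrix V V ℝ) - G.adjMatrix ℝ with hM
  have hherm : M.IsHermitian := by
    rw [Matrix.IsHermitian, Matrix.conjTranspose_eq_transpose_of_trivial, hM]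
    simp
  have hpos : M.PosDef := by
    rw [hherm.posDef_iff_eigenvalues_pos]
    intro i
    have h := hherm.mulVec_eigenvectorBasis i
    set x : V → ℝ := ⇑(hherm.eigenvectorBasis i) with hx
    have hx0 : x ≠ 0 := fun h0 => hherm.eigenvectorBasis.toBasis.ne_zero i (by
      ext v
      simpa using congrFun h0 v)
    have hev : Module.End.HasEigenvalue (Matrix.toLin' (G.adjMatrix ℝ))
        (q - hherm.eigenvalues i) := by
      refine Module.End.hasEigenvalue_of_hasEigenvector (x := x)
        ⟨Module.End.mem_eigenspace_iff.2 ?_, hx0⟩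
      have hMx : M.mulVec x = q • x - (G.adjMatrix ℝ).mulVec x := by
        rw [hM, Matrix.sub_mulVec, Matrix.smul_mulVec, Matrix.one_mulVec]
      rw [Matrix.toLin'_apply, sub_smul, ← h, hMx, sub_sub_cancel]
    have := le_specRadius_of_hasEigenvalue hev
    linarith
  set x : V → ℝ := fun v => if v ∈ K then 1 else 0 with hx
  have hx0 : x ≠ 0 := by
    obtain ⟨v, hv⟩ := hne
    exact fun h => by simpa [hx, hv] using congrFun h v
  have h := hpos.re_dotProduct_pos hx0
  have hrow : ∀ v ∈ K, M.mulVec x v = 0 := by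
    intro v hv
    have h1 : G.neighborFinset v ∩ K = K.erase v := by
      ext u
      simp only [Finset.mem_inter, SimpleGraph.mem_neighborFinset, Finset.mem_erase]
      constructor
      · exact fun h => ⟨h.1.ne', h.2⟩
      · exact fun h => ⟨hK hv h.2 (Ne.symm h.1), h.2⟩
    have h2 : ((K.erase v).card : ℝ) = q := by
      rw [Finset.cast_card_erase_of_mem hv]
    rw [hM, Matrix.sub_mulVec, Matrix.smul_mulVec, Matrix.one_mulVec, Pi.sub_apply, Pi.smul_apply,
      SimpleGraph.adjMatrix_mulVec_apply, hx, Finset.sum_ite_mem, h1]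
    simp [hv, h2, -Finset.card_erase_of_mem]
  refine h.ne' ?_
  rw [dotProduct, map_sum]
  refine Finset.sum_eq_zero fun v _ => ?_
  by_cases hv : v ∈ K
  · simp [hrow v hv]
  · simp [hx, hv]

theorem card_sub_one_le_specRadius_cliqueJoin {a b : ℕ} (c : ℕ) (hab : 1 ≤ a + b) :
    (a : ℝ) + b - 1 ≤ specRadius (cliqueJoin a b c) := by
  set K : Finset (Fin a ⊕ (Fin b ⊕ Fin c)) :=
    Finset.univ.disjSum (Finset.univ.disjSum ∅) with hK
  have hcard : K.card = a + b := by simp [hK]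
  have hclique : (cliqueJoin a b c).IsClique K := by
    rintro (u | u | u) hu (v | v | v) hv huv <;>
      simp_all [cliqueJoin, join]
  have := card_sub_one_le_specRadius hclique (Finset.card_pos.1 (by omega))
  rw [hcard] at this
  exact_mod_cast this

/-- The combinatorial part of Hong's bound: for a connected graph with `n` vertices and `m` edges,
the row sum of the squared adjacency matrix at `v` is at most `2m - n + 1`. Indeed it equals `2m`
less the degree of `v` and less the degrees of the vertices other than `v` that are not neighbours of
`v`, which are positive. -/
theorem sum_degree_neighbors_add_le (hG : G.Connected) (v : V) :
    ∑ u ∈ G.neighborFinset v, G.degree u + Fintype.card V ≤ ∑ u, G.degree u + 1 := by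
  by_cases hV : Nontrivial V
  · have hpos : ∀ u, 1 ≤ G.degree u := fun u => hG.preconnected.degree_pos_of_nontrivial u
    have h1 := Finset.sum_add_sum_compl (G.neighborFinset v) fun u => G.degree u
    have hv : v ∈ (G.neighborFinset v)ᶜ := by simp
    have h2 := Finset.add_sum_erase _ (fun u => G.degree u) hv
    have h3 : ((G.neighborFinset v)ᶜ.erase v).card ≤
        ∑ u ∈ (G.neighborFinset v)ᶜ.erase v, G.degree u := by
      rw [Finset.card_eq_sum_ones]
      exact Finset.sum_le_sum fun u _ => hpos u
    have h4 := Finset.card_erase_add_one hv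
    have h5 := Finset.card_add_card_compl (G.neighborFinset v)
    rw [SimpleGraph.card_neighborFinset_eq_degree] at h5
    omega
  · rw [not_nontrivial_iff_subsingleton] at hV
    have : Fintype.card V ≤ 1 := Fintype.card_le_one_iff_subsingleton.2 hV
    have h : ∑ u ∈ G.neighborFinset v, G.degree u ≤ ∑ u, G.degree u :=
      Finset.sum_le_sum_of_subset (Finset.subset_univ _)
    omega

end Spectral

/-! ### Counting edges outside a separating set -/

section Counting

open Classical

variable {V : Type*} [Fintype V] {G : SimpleGraph V}

theorem sum_ncard_supp {W : Type*} [Fintype W] (F : SimpleGraph W) :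
    ∑ C : F.ConnectedComponent, C.supp.ncard = Fintype.card W := by
  rw [← Finset.card_univ, Finset.card_eq_sum_card_fiberwise (f := F.connectedComponentMk)
    (t := Finset.univ) (fun _ _ => Finset.mem_coe.2 (Finset.mem_univ _))]
  refine Finset.sum_congr rfl fun C _ => ?_
  rw [← Set.ncard_coe_finset]
  congr 1
  ext v
  simp

theorem one_le_ncard_supp {W : Type*} [Finite W] {F : SimpleGraph W} (C : F.ConnectedComponent) :
    1 ≤ C.supp.ncard :=
  (Set.ncard_pos (Set.toFinite _)).2 C.nonempty_supp

/-- A component leaves at least one vertex to each of the others. -/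
theorem ncard_supp_add_card_le {W : Type*} [Fintype W] {F : SimpleGraph W}
    (C : F.ConnectedComponent) :
    C.supp.ncard + Nat.card F.ConnectedComponent ≤ Fintype.card W + 1 := by
  have h1 := Finset.add_sum_erase Finset.univ (fun C : F.ConnectedComponent => C.supp.ncard)
    (Finset.mem_univ C)
  have h2 : (Finset.univ.erase C).card ≤ ∑ D ∈ Finset.univ.erase C, D.supp.ncard := by
    rw [Finset.card_eq_sum_ones]
    exact Finset.sum_le_sum fun D _ => one_le_ncard_supp D
  have h3 := Finset.card_erase_add_one (Finset.mem_univ C)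
  rw [sum_ncard_supp] at h1
  rw [Nat.card_eq_fintype_card, ← Finset.card_univ]
  omega

theorem ncard_supp_add_card_le_of_two_le {W : Type*} [Fintype W] {F : SimpleGraph W}
    {C D : F.ConnectedComponent} (hDC : D ≠ C) (hD : 2 ≤ D.supp.ncard) :
    C.supp.ncard + Nat.card F.ConnectedComponent ≤ Fintype.card W := by
  have h1 := Finset.add_sum_erase Finset.univ (fun C : F.ConnectedComponent => C.supp.ncard)
    (Finset.mem_univ C)
  have h2 : (Finset.univ.erase C).card < ∑ D ∈ Finset.univ.erase C, D.supp.ncard := by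
    rw [Finset.card_eq_sum_ones]
    exact Finset.sum_lt_sum (fun D _ => one_le_ncard_supp D)
      ⟨D, Finset.mem_erase.2 ⟨hDC, Finset.mem_univ _⟩, hD⟩
  have h3 := Finset.card_erase_add_one (Finset.mem_univ C)
  rw [sum_ncard_supp] at h1
  rw [Nat.card_eq_fintype_card, ← Finset.card_univ]
  omega

/-- A graph all of whose components have at most `M` vertices has at most
`M (|W| - c) / 2` edges, where `c` is the number of components: a component with `m` vertices
contributes at most `m (m - 1) ≤ M (m - 1)` to the sum of the degrees. -/
theorem sum_degree_add_mul_card_le {W : Type*} [Fintype W] {F : SimpleGraph W}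
    [∀ v, Fintype (F.neighborSet v)] {M : ℕ} (hM : ∀ C : F.ConnectedComponent, C.supp.ncard ≤ M) :
    ∑ v, F.degree v + M * Nat.card F.ConnectedComponent ≤ M * Fintype.card W := by
  have hC : ∀ C : F.ConnectedComponent,
      ∑ v with F.connectedComponentMk v = C, F.degree v + M ≤ M * C.supp.ncard := by
    intro C
    obtain ⟨m, hm⟩ : ∃ m, C.supp.ncard = m + 1 :=
      ⟨_, (Nat.sub_add_cancel (one_le_ncard_supp C)).symm⟩
    have hcard : (Finset.univ.filter fun v => F.connectedComponentMk v = C).card = m + 1 := by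
      rw [← hm, ← Set.ncard_coe_finset]
      congr 1
      ext v
      simp
    have hdeg : ∀ v ∈ Finset.univ.filter fun v => F.connectedComponentMk v = C,
        F.degree v ≤ m := by
      intro v hv
      have hsub : F.neighborFinset v ⊆
          (Finset.univ.filter fun v => F.connectedComponentMk v = C).erase v := by
        intro u hu
        rw [SimpleGraph.mem_neighborFinset] at hu
        refine Finset.mem_erase.2 ⟨hu.ne', Finset.mem_filter.2 ⟨Finset.mem_univ _, ?_⟩⟩
        rw [← (Finset.mem_filter.1 hv).2]
        exact SimpleGraph.ConnectedComponent.sound hu.symm.reachable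
      have := Finset.card_le_card hsub
      rwa [Finset.card_erase_of_mem hv, hcard, SimpleGraph.card_neighborFinset_eq_degree] at this
    have hsum := Finset.sum_le_card_nsmul _ _ _ hdeg
    rw [hcard, smul_eq_mul] at hsum
    have := Nat.mul_le_mul_right m (hm ▸ hM C)
    rw [hm, mul_add, mul_one]
    omega
  have hsum := Finset.sum_le_sum fun C (_ : C ∈ Finset.univ) => hC C
  rwa [Finset.sum_add_distrib, ← Finset.mul_sum, sum_ncard_supp,
    Finset.sum_fiberwise Finset.univ F.connectedComponentMk (fun v => F.degree v),
    Finset.sum_const, Finset.card_univ, smul_eq_mul, ← Nat.card_eq_fintype_card, mul_comm _ M]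
    at hsum

theorem sum_filter_notMem_le {S : Finset V} {p M : ℕ}
    (hp : Fintype.card V = S.card + compCount G S + p)
    (hM : ∀ C : (G.induce (S : Set V)ᶜ).ConnectedComponent, C.supp.ncard ≤ M) :
    ∑ v ∈ Sᶜ, ((G.neighborFinset v).filter (· ∉ S)).card ≤ M * p := by
  have h := sum_degree_add_mul_card_le hM
  rw [sum_induce_degree G _ Sᶜ (by simp)] at h
  have hW : Fintype.card ((S : Set V)ᶜ : Set V) = compCount G S + p := by
    have := card_compl_coe S
    omega
  rw [hW, mul_add] at h
  unfold compCount at h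
  simp only [Finset.mem_coe, Set.mem_compl_iff] at h
  omega

/-- Twice the number of edges, bounded by the parts inside `S`, between `S` and its complement, and
outside `S`. The vertices of `H` may be joined to all of `S`, the others outside `S` to at most `f`
vertices of `S`. -/
theorem sum_degree_le {S H : Finset V} {f : ℕ} (hSH : Disjoint S H)
    (hf : ∀ x, x ∉ S → x ∉ H → ((G.neighborFinset x).filter (· ∈ S)).card ≤ f) :
    ∑ v, G.degree v ≤ S.card * (S.card - 1) +
      2 * (f * (Fintype.card V - S.card - H.card) + S.card * H.card) +
      ∑ v ∈ Sᶜ, ((G.neighborFinset v).filter (· ∉ S)).card := by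
  have hsplit : ∀ v, G.degree v = ((G.neighborFinset v).filter (· ∈ S)).card +
      ((G.neighborFinset v).filter (· ∉ S)).card := fun v => by
    rw [Finset.card_filter_add_card_filter_not, SimpleGraph.card_neighborFinset_eq_degree]
  have hin : ∑ v ∈ S, ((G.neighborFinset v).filter (· ∈ S)).card ≤ S.card * (S.card - 1) := by
    rw [← smul_eq_mul]
    refine Finset.sum_le_card_nsmul _ _ _ fun v hv => ?_
    rw [← Finset.card_erase_of_mem hv]
    refine Finset.card_le_card fun u hu => ?_
    rw [Finset.mem_filter, SimpleGraph.mem_neighborFinset] at hu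
    exact Finset.mem_erase.2 ⟨hu.1.ne', hu.2⟩
  have hH : H ⊆ Sᶜ := fun x hx => Finset.mem_compl.2 fun hxS => Finset.disjoint_left.1 hSH hxS hx
  have hcross : ∑ v ∈ Sᶜ, ((G.neighborFinset v).filter (· ∈ S)).card ≤
      f * (Fintype.card V - S.card - H.card) + S.card * H.card := by
    rw [← Finset.sum_sdiff hH, ← Finset.card_compl, ← Finset.card_sdiff_of_subset hH, mul_comm f,
      mul_comm S.card, ← smul_eq_mul, ← smul_eq_mul]
    refine Nat.add_le_add (Finset.sum_le_card_nsmul _ _ _ fun v hv => ?_)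
      (Finset.sum_le_card_nsmul _ _ _ fun v _ => Finset.card_le_card fun u hu =>
        (Finset.mem_filter.1 hu).2)
    rw [Finset.mem_sdiff, Finset.mem_compl] at hv
    exact hf v hv.1 hv.2
  rw [← Finset.sum_add_sum_compl S]
  simp only [hsplit, Finset.sum_add_distrib]
  rw [sum_filter_notMem_eq]
  omega

/-- Two vertices whose only neighbour is `v` and any third vertex other than `v` lie in distinct
components of `G - v`. -/
theorem three_le_compCount_singleton {v x₁ x₂ y : V} (h₁ : ∀ z, G.Adj x₁ z → z = v)
    (h₂ : ∀ z, G.Adj x₂ z → z = v) (h₁v : x₁ ≠ v) (h₂v : x₂ ≠ v) (hyv : y ≠ v) (h₁₂ : x₁ ≠ x₂)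
    (h₁y : x₁ ≠ y) (h₂y : x₂ ≠ y) : 3 ≤ compCount G {v} := by
  set F := G.induce ((({v} : Finset V) : Set V)ᶜ) with hF
  have hmem : ∀ {x}, x ≠ v → x ∈ ((({v} : Finset V) : Set V)ᶜ) := fun h => by simpa using h
  have hiso : ∀ {x z : V} (hx : x ≠ v) (hz : z ≠ v), (∀ z, G.Adj x z → z = v) → x ≠ z →
      F.connectedComponentMk ⟨x, hmem hx⟩ ≠ F.connectedComponentMk ⟨z, hmem hz⟩ := by
    intro x z hx hz h hxz hC
    obtain ⟨p⟩ := SimpleGraph.ConnectedComponent.exact hC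
    cases p with
    | nil => exact hxz rfl
    | @cons _ w _ hw _ => exact (by simpa using w.2 : (w : V) ≠ v) (h w hw)
  have hcard : ({F.connectedComponentMk ⟨x₁, hmem h₁v⟩, F.connectedComponentMk ⟨x₂, hmem h₂v⟩,
      F.connectedComponentMk ⟨y, hmem hyv⟩} : Finset F.ConnectedComponent).card = 3 :=
    Finset.card_eq_three.2 ⟨_, _, _, hiso h₁v h₂v h₁ h₁₂, hiso h₁v hyv h₁ h₁y,
      hiso h₂v hyv h₂ h₂y, rfl⟩
  rw [compCount, Nat.card_eq_fintype_card, ← hcard]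
  exact Finset.card_le_univ _

/-- If all components of `G - S` but one are single vertices with just one neighbour in `S`, and
there are more than `|S| ≥ 2` of them, then two of them share their neighbour `v`, and removing `v`
alone leaves at least three components. -/
theorem exists_three_le_compCount_singleton (hG : G.Connected) {S : Finset V} (hS : 2 ≤ S.card)
    (hcount : S.card + 2 ≤ compCount G S) (C : (G.induce (S : Set V)ᶜ).ConnectedComponent)
    (hC : ∀ D : (G.induce (S : Set V)ᶜ).ConnectedComponent, D ≠ C → D.supp.ncard ≤ 1)
    (hone : ∀ x, x ∉ S → (∀ y, G.Adj x y → y ∈ S) →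
      ((G.neighborFinset x).filter (· ∈ S)).card ≤ 1) :
    ∃ v, 3 ≤ compCount G {v} := by
  have hV : Nontrivial V := by
    obtain ⟨a, -, b, -, hab⟩ := Finset.one_lt_card.1 (show 1 < S.card by omega)
    exact ⟨a, b, hab⟩
  have key : ∀ D : {D : (G.induce (S : Set V)ᶜ).ConnectedComponent // D ≠ C},
      ∃ x : ((S : Set V)ᶜ : Set V), (G.induce (S : Set V)ᶜ).connectedComponentMk x = D ∧
        ∃ v : S, ∀ z, G.Adj x z → z = v := by
    rintro ⟨D, hD⟩
    obtain ⟨x, hx⟩ := D.nonempty_supp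
    have hxS : (x : V) ∉ S := fun h => x.2 (Finset.mem_coe.2 h)
    have hnb : ∀ y, G.Adj x y → y ∈ S := by
      intro y hxy
      by_contra hy
      have hy' : y ∈ (S : Set V)ᶜ := by simpa using hy
      have hadj : (G.induce (S : Set V)ᶜ).Adj x ⟨y, hy'⟩ := hxy
      have hyD : (⟨y, hy'⟩ : ((S : Set V)ᶜ : Set V)) ∈ D.supp := by
        rw [SimpleGraph.ConnectedComponent.mem_supp_iff] at hx ⊢
        rw [← hx]
        exact SimpleGraph.ConnectedComponent.sound hadj.symm.reachable
      have := (Set.ncard_le_one (Set.toFinite _)).1 (hC D hD) _ hx _ hyD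
      exact hadj.ne this
    obtain ⟨v, hv⟩ : ∃ v, G.Adj x v := by
      have := hG.preconnected.degree_pos_of_nontrivial (x : V)
      exact (SimpleGraph.degree_pos_iff_exists_adj G _).1 this
    refine ⟨x, hx, ⟨v, hnb v hv⟩, fun z hz => ?_⟩
    exact Finset.card_le_one.1 (hone x hxS hnb) z (by simp [hz, hnb z hz]) v
      (by simp [hv, hnb v hv])
  choose x hxD v hv using key
  obtain ⟨D, D', hne, hvv⟩ := Fintype.exists_ne_map_eq_of_card_lt v (by
    rw [Fintype.card_coe, Fintype.card_subtype_compl, Fintype.card_subtype_eq,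
      ← Nat.card_eq_fintype_card]
    have : compCount G S = Nat.card (G.induce (S : Set V)ᶜ).ConnectedComponent := rfl
    omega)
  obtain ⟨y, hyS, hyv⟩ := Finset.exists_mem_ne (show 1 < S.card by omega) (v D : V)
  have hxS : ∀ D, ∀ w ∈ S, (x D : V) ≠ w := by
    rintro D w hw rfl
    exact (x D).2 (Finset.mem_coe.2 hw)
  refine ⟨v D, three_le_compCount_singleton (x₁ := x D) (x₂ := x D') (y := y) (hv D)
    (fun z hz => hvv ▸ hv D' z hz) (hxS _ _ (v D).2) (hxS _ _ (v D).2) hyv ?_ (hxS _ _ hyS)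
    (hxS _ _ hyS)⟩
  intro h
  refine hne (Subtype.ext ?_)
  rw [← hxD D, ← hxD D', Subtype.ext h]

end Counting

/-! ### The inequality between integers -/

section Arithmetic

/-- The case `K = 1` of `edge_bound_lt` in terms of `D = s - 3t`. -/
theorem edge_bound_lt_of_one {f s p h D : ℤ} (hf : 1 ≤ f) (hp : 0 ≤ p) (hD0 : f - 1 ≤ D)
    (hh : h ≤ p + f - 1) (hpD : 7 - f ≤ 2 * D + p) (hsD : D + 3 ≤ s) (hsf : f + 2 ≤ s)
    (hc : D = 0 → 5 ≤ s) :
    s ^ 2 + p ^ 2 - 3 * s + 2 * f * s + 3 * f + 2 * f ^ 2 + 2 * f * p + 2 * (s - f) * h - 1 <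
      (s + p + (f - 1 + D)) ^ 2 := by
  have hh1 : (s - f) * h ≤ (s - f) * (p + f - 1) := by
    apply mul_le_mul_of_nonneg_left <;> linarith
  rcases hf.eq_or_lt with rfl | hf2
  · rcases (show 0 ≤ D by linarith).eq_or_lt with h0 | h0
    · have := hc h0.symm
      rw [← h0]
      nlinarith
    · nlinarith [mul_pos h0 (show 0 < s by linarith), mul_nonneg h0.le hp]
  · have e1 : 2 * (f - 1) ≤ f - 1 + D := by linarith
    have e2 : (s + p) * (2 * (f - 1)) ≤ (s + p) * (f - 1 + D) :=
      mul_le_mul_of_nonneg_left e1 (by linarith)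
    have e3 : (2 * (f - 1)) ^ 2 ≤ (f - 1 + D) ^ 2 := by
      apply pow_le_pow_left₀ <;> linarith
    rcases (show 3 ≤ f ∨ f = 2 by omega) with h3 | rfl
    · nlinarith [mul_nonneg hp (show 0 ≤ f - 1 by linarith)]
    · nlinarith

/-- The case `K ≥ 2` of `edge_bound_lt` in terms of `D = s - 3t`. -/
theorem edge_bound_lt_of_two_le {K f s p h D : ℤ} (hK2 : 2 ≤ K) (hf : 1 ≤ f) (hp : 0 ≤ p)
    (hh0 : 0 ≤ h) (hD0 : f - 1 ≤ D) (hh : K * h ≤ p + f - 1) (hpD : K + 6 - f ≤ (K + 1) * D + p)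
    (hsD : D + 3 ≤ s) (hsf : f + 2 ≤ s) (hs0 : D = f - 1 → 2 ≤ f → s = f + 2) :
    s ^ 2 + p ^ 2 - (K + 2) * s + 2 * f * K * s + 3 * f + 2 * f ^ 2 + 2 * f * p +
      2 * (s - f) * h - 1 < (s + p + (f - 1 + K * D)) ^ 2 := by
  rcases hf.eq_or_lt with rfl | hf2
  · rcases (show 0 ≤ D by linarith).eq_or_lt with h0 | h0
    · have hs3 : 3 ≤ s := by linarith
      rw [← h0] at hpD ⊢
      -- here `h ≤ p / K`, while `p ≥ K + 5`
      rcases (show K = 2 ∨ K = 3 ∨ 4 ≤ K by omega) with rfl | rfl | hK4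
      · nlinarith
      · nlinarith
      · have : 4 * h ≤ p := by nlinarith
        nlinarith
    · have h2 : 2 * h ≤ p := by nlinarith
      have e1 : (s - 1) * (2 * h) ≤ (s - 1) * p := mul_le_mul_of_nonneg_left h2 (by linarith)
      have e2 : (s + p) * K ≤ (s + p) * (1 - 1 + K * D) := by
        apply mul_le_mul_of_nonneg_left <;> nlinarith
      have e3 : K ^ 2 ≤ (1 - 1 + K * D) ^ 2 := by
        apply pow_le_pow_left₀ <;> nlinarith
      nlinarith [mul_nonneg hp (show 0 ≤ s by linarith), mul_nonneg hp (show 0 ≤ K by linarith)]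
  · have h2 : 2 * h ≤ p + f - 1 := by nlinarith
    have e1 : (s - f) * (2 * h) ≤ (s - f) * (p + f - 1) :=
      mul_le_mul_of_nonneg_left h2 (by linarith)
    rcases (show f - 1 < D ∨ D = f - 1 by omega) with h0 | h0
    · have e0 : f - 1 + K * f ≤ f - 1 + K * D := by nlinarith
      have e2 : (s + p) * (f - 1 + K * f) ≤ (s + p) * (f - 1 + K * D) :=
        mul_le_mul_of_nonneg_left e0 (by linarith)
      have e3 : (f - 1 + K * f) ^ 2 ≤ (f - 1 + K * D) ^ 2 := by
        apply pow_le_pow_left₀ _ e0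
        nlinarith
      have e4 : 0 ≤ p * (f - 1 + K * f) := mul_nonneg hp (by nlinarith)
      have e5 : 0 ≤ (s - f) * p := mul_nonneg (by linarith) hp
      have e6 : (f + 2) * (f - 1) ≤ s * (f - 1) :=
        mul_le_mul_of_nonneg_right hsf (by linarith)
      have e7 : 4 * s ≤ (K + 2) * s := mul_le_mul_of_nonneg_right (by linarith) (by linarith)
      have e8 := sq_nonneg (f - 1 + K * f)
      linarith
    · have hs' : s = f + 2 := hs0 h0 (by linarith)
      obtain ⟨g, rfl⟩ : ∃ g, f = g + 1 := ⟨f - 1, by ring⟩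
      subst hs'
      have h4 : h ≤ p + g := by
        have := mul_nonneg (show 0 ≤ K - 1 by linarith) hh0
        linarith
      subst h0
      have hg : 1 ≤ g := by linarith
      obtain ⟨J, rfl⟩ : ∃ J, K = J - 1 := ⟨K + 1, by ring⟩
      have hJ : 3 ≤ J := by linarith
      have e2 : 0 ≤ p * (J * g) := mul_nonneg hp (by nlinarith)
      rcases (show g = 1 ∨ 2 ≤ g by omega) with rfl | hg2
      · have : 3 ≤ p := by linarith
        nlinarith
      · have e3 : 6 ≤ J * g := by nlinarith
        have e4 : (3 * g) * (J * g) ≤ (J * g) * (J * g) :=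
          mul_le_mul_of_nonneg_right (mul_le_mul_of_nonneg_right hJ (by linarith)) (by linarith)
        have e5 : 6 * (J * g) ≤ (3 * g) * (J * g) :=
          mul_le_mul_of_nonneg_right (by linarith) (by linarith)
        have e6 : 2 * J ≤ J * g := by nlinarith
        have e7 : 3 * g ≤ J * g := by nlinarith
        linarith

/-- The estimate `2m - n + 1 < q²` for `q = n - 3tK - 3`, where `K = k - 2`, for the bound on `2m`
in terms of `s = |S|`, `h = |H|`, the excess `f` of the number of components of `G - S` over
`Ks + 2`, and the number `p` of vertices outside `S` in excess of the number of these components. -/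
theorem edge_bound_lt {K t f s p h n : ℤ} (hK : 1 ≤ K) (ht : 1 ≤ t) (hf : 1 ≤ f)
    (hs : t * (f + 2) ≤ s) (hp : 0 ≤ p) (hh : 0 ≤ h) (hh' : K * h ≤ p + f - 1)
    (hn : n = (K + 1) * s + 2 + f + p) (hn' : 3 * (K + 1) * t + K + 8 ≤ n)
    (hc : ¬ (K = 1 ∧ s = 3)) :
    s * (s - 1) + 2 * (f * (n - s - h) + s * h) + p * (p + 1) - n + 1 <
      (n - 3 * t * K - 3) ^ 2 := by
  obtain ⟨D, hD⟩ : ∃ D, D = s - 3 * t := ⟨_, rfl⟩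
  have hDf : t * (f - 1) ≤ D := by rw [hD]; linarith
  have hDf' : f - 1 ≤ D := by nlinarith
  have hpD : K + 6 - f ≤ (K + 1) * D + p := by rw [hD]; nlinarith
  have hsD : D + 3 ≤ s := by linarith
  have hsf : f + 2 ≤ s := by linarith
  have hq : n - 3 * t * K - 3 = s + p + (f - 1 + K * D) := by rw [hn, hD]; ring
  rw [hq]
  have hleft : s * (s - 1) + 2 * (f * (n - s - h) + s * h) + p * (p + 1) - n + 1 =
      s ^ 2 + p ^ 2 - (K + 2) * s + 2 * f * K * s + 3 * f + 2 * f ^ 2 + 2 * f * p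
        + 2 * (s - f) * h - 1 := by
    rw [hn]; ring
  rw [hleft]
  clear hleft hq hn hn'
  rcases hK.eq_or_lt with rfl | hK2
  · have := edge_bound_lt_of_one hf hp hDf' (by linarith) (by linarith) hsD hsf
      (h := h) fun h0 => by
        have : s ≠ 3 := fun h => hc ⟨rfl, h⟩
        omega
    linarith
  · refine edge_bound_lt_of_two_le hK2 hf hp hh hDf' hh' hpD hsD hsf fun h0 hf2 => ?_
    -- equality in `t (f - 1) ≤ D` forces `t = 1`
    have ht1 : t = 1 := by nlinarith
    subst ht1
    linarith

end Arithmetic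

/-! ### Tough graphs without spanning `k`-tree -/

section EdgeCount

open Classical

variable {V : Type*} [Fintype V] {G : SimpleGraph V}

/-- The degree sum of a tough connected graph without spanning `k`-tree is so small that Hong's
bound `√(2m - n + 1)` is below `n - 3t(k - 2) - 3`. Here `K = k - 2`. -/
theorem sum_degree_lt {K t : ℕ} (hK : 1 ≤ K) (ht : 1 ≤ t) (hG : G.Connected)
    (htough : IsTough G ((t : ℝ) / ((t : ℝ) * K + 1)))
    (hn : 3 * (K + 1) * t + K + 8 ≤ Fintype.card V) (hno : ¬ HasSpanningKTree G (K + 2)) :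
    (∑ v, G.degree v : ℤ) - Fintype.card V + 1 <
      ((Fintype.card V : ℤ) - 3 * t * K - 3) ^ 2 := by
  obtain ⟨S, H, f, hf, hc, hSH, hH, hlow, hiso⟩ := exists_obstruction (by omega) hG hno
  simp only [Nat.add_sub_cancel, show K + 2 - 1 = K + 1 from rfl] at hc hH
  -- the excess of the number of components, at least `f`
  obtain ⟨F, hF⟩ : ∃ F, compCount G S = K * S.card + 2 + F :=
    ⟨_, (Nat.add_sub_of_le (by omega)).symm⟩
  have hfF : f ≤ F := by omega
  have htough' : ∀ A : Finset V, 2 ≤ compCount G A →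
      t * compCount G A ≤ A.card * (t * K + 1) := fun A hA => by
    have := htough A hA
    rw [div_mul_eq_mul_div, div_le_iff₀ (by positivity)] at this
    exact_mod_cast this
  have hs : t * (F + 2) ≤ S.card := by
    have := htough' S (by omega)
    rw [hF] at this
    linarith
  have hcW : compCount G S + S.card ≤ Fintype.card V := by
    rw [← card_compl_coe S, Nat.add_le_add_iff_right, compCount, ← Nat.card_eq_fintype_card]
    exact Nat.card_le_card_of_surjective _ Quot.mk_surjective
  obtain ⟨p, hp⟩ : ∃ p, Fintype.card V = S.card + compCount G S + p :=
    ⟨_, (Nat.add_sub_of_le (by omega)).symm⟩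
  have hSHn : S.card + H.card ≤ Fintype.card V := by
    rw [← Finset.card_union_of_disjoint hSH]
    exact Finset.card_le_univ _
  have hlow' : ∀ x, x ∉ S → x ∉ H → ((G.neighborFinset x).filter (· ∈ S)).card ≤ F :=
    fun x hxS hxH => (hlow x hxS hxH).trans hfF
  have hsum := sum_degree_le hSH hlow'
  have hcast : ((S.card * (S.card - 1) + 2 * (F * (Fintype.card V - S.card - H.card) +
      S.card * H.card) : ℕ) : ℤ) = (S.card : ℤ) * (S.card - 1) +
        2 * (F * (Fintype.card V - S.card - H.card) + S.card * H.card) := by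
    have h1 : 1 ≤ S.card := le_trans (Nat.mul_pos ht (by omega)) hs
    push_cast [Nat.cast_sub h1, Nat.cast_sub (show S.card ≤ Fintype.card V by omega),
      Nat.cast_sub (show H.card ≤ Fintype.card V - S.card by omega)]
    ring
  have hdim : ∀ C : (G.induce (S : Set V)ᶜ).ConnectedComponent, C.supp.ncard ≤ p + 1 := fun C => by
    have := ncard_supp_add_card_le C
    have h2 := card_compl_coe S
    have h3 : compCount G S = Nat.card (G.induce (S : Set V)ᶜ).ConnectedComponent := rfl
    omega
  have hp' : Fintype.card V = (K + 1) * S.card + 2 + F + p := by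
    rw [hp, hF]
    ring
  have hKH : K * H.card + 1 ≤ p + F := by
    rw [hp'] at hH
    omega
  by_cases hcorner : K = 1 ∧ S.card = 3
  · obtain ⟨rfl, hS3⟩ := hcorner
    rw [hS3] at hs
    obtain rfl : t = 1 := by
      have := Nat.mul_le_mul_left t (show 3 ≤ F + 2 by omega)
      omega
    obtain rfl : F = 1 := by omega
    -- if the components other than `C` were single vertices, deleting one vertex of `S` would
    -- leave three components
    have hM : ∀ C : (G.induce (S : Set V)ᶜ).ConnectedComponent, C.supp.ncard ≤ p := by
      intro C
      by_contra! hC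
      obtain ⟨v, hv⟩ := exists_three_le_compCount_singleton hG (S := S) (by omega) (by omega) C
        (fun D hD => by
          by_contra! h2
          have := ncard_supp_add_card_le_of_two_le hD h2
          have h2 := card_compl_coe S
          have h3 : compCount G S = Nat.card (G.induce (S : Set V)ᶜ).ConnectedComponent := rfl
          omega)
        (fun x hxS hx => hlow' x hxS fun hxH => by
          have := hiso x hxH hx
          omega)
      have := htough' {v} (by omega)
      rw [Finset.card_singleton] at this
      omega
    have hout := sum_filter_notMem_le hp hM
    have hle := hsum.trans (Nat.add_le_add_left hout _)
    zify at hle hp' hKH hn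
    zify at hcast
    rw [hcast, hS3] at hle
    rw [hS3] at hp'
    push_cast at hle hp' hn ⊢
    rw [hp'] at hle ⊢
    linarith
  · have hout := sum_filter_notMem_le hp hdim
    have hle := hsum.trans (Nat.add_le_add_left hout _)
    have := edge_bound_lt (K := K) (t := t) (f := F) (s := S.card) (p := p) (h := H.card)
      (n := Fintype.card V) (by omega) (by omega) (by omega) (by exact_mod_cast hs) (by omega)
      (by omega) (by zify at hKH; linarith) (by exact_mod_cast hp') (by exact_mod_cast hn)
      (by exact_mod_cast hcorner)
    zify at hle
    zify at hcast
    rw [hcast] at hle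
    linarith

end EdgeCount

end ToughTree

theorem theorem1p2 (k t : ℕ) (hk : 3 ≤ k) (ht : 1 ≤ t) {V : Type*} [Fintype V]
    (G : SimpleGraph V) (hconn : G.Connected)
    (htough : ToughTree.IsTough G ((t : ℝ) / ((t : ℝ) * ((k : ℝ) - 2) + 1)))
    (hn : 3 * (k : ℤ) * (t : ℤ) + (k : ℤ) - 3 * (t : ℤ) + 6 ≤ (Fintype.card V : ℤ))
    (hrho : ToughTree.specRadius (ToughTree.cliqueJoin (3 * t)
        (Fintype.card V - 3 * t * (k - 1) - 2) (3 * t * (k - 2) + 2)) ≤ ToughTree.specRadius G) :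
    ToughTree.HasSpanningKTree G k ∨
      Nonempty (G ≃g ToughTree.cliqueJoin (3 * t)
        (Fintype.card V - 3 * t * (k - 1) - 2) (3 * t * (k - 2) + 2)) := by
  classical
  refine Or.inl ?_
  by_contra hno
  obtain ⟨K, rfl⟩ : ∃ K, k = K + 2 := ⟨k - 2, by omega⟩
  have hn' : 3 * (K + 1) * t + K + 8 ≤ Fintype.card V := by
    zify
    push_cast at hn
    linarith
  have hlt := ToughTree.sum_degree_lt (by omega) ht hconn
    (by simpa only [Nat.cast_add, Nat.cast_ofNat, add_sub_cancel_right] using htough) hn' hno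
  -- the parts `K_{3t}` and `K_b` form a complete subgraph with `q + 1` vertices
  have hclique := ToughTree.card_sub_one_le_specRadius_cliqueJoin (a := 3 * t)
    (b := Fintype.card V - 3 * t * (K + 2 - 1) - 2) (3 * t * (K + 2 - 2) + 2) (by omega)
  obtain ⟨b, hb⟩ : ∃ b, Fintype.card V = 3 * t * (K + 1) + 2 + b :=
    ⟨Fintype.card V - (3 * t * (K + 1) + 2), by
      have : 3 * (K + 1) * t = 3 * t * (K + 1) := by ring
      omega⟩
  have hb' : ((Fintype.card V - 3 * t * (K + 2 - 1) - 2 : ℕ) : ℝ) = b := by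
    congr 1
    rw [show K + 2 - 1 = K + 1 from rfl]
    omega
  have hhong := ToughTree.specRadius_le_sqrt (G := G)
    (B := ((∑ u, G.degree u : ℕ) : ℝ) - Fintype.card V + 1) fun v => by
      have := ToughTree.sum_degree_neighbors_add_le hconn v
      have : ((∑ u ∈ G.neighborFinset v, G.degree u : ℕ) : ℝ) + Fintype.card V ≤
        ((∑ u, G.degree u : ℕ) : ℝ) + 1 := by exact_mod_cast this
      linarith
  have hlt' : ((∑ u, G.degree u : ℕ) : ℝ) - Fintype.card V + 1 <
      ((3 * t : ℕ) + (b : ℝ) - 1) ^ 2 := by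
    have h1 : (Fintype.card V : ℤ) - 3 * t * K - 3 = 3 * t + b - 1 := by
      rw [hb]
      push_cast
      ring
    rw [h1] at hlt
    exact_mod_cast hlt
  have hpos : 0 < ((3 * t : ℕ) : ℝ) + (b : ℝ) - 1 := by
    have : (1 : ℝ) < ((3 * t : ℕ) : ℝ) := by exact_mod_cast (by omega : 1 < 3 * t)
    have : (0 : ℝ) ≤ b := b.cast_nonneg
    linarith
  have := (Real.sqrt_lt' hpos).2 hlt'
  linarith
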